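/- Use the upper half-space model $\mathbb{H}^3=\{(\zeta,w)\in\mathbb{C}\times\mathbb{R}: w>0\}$ with metric $(|d\zeta|^2+dw^2)/w^2$ and the orientation of the coordinates $(\operatorname{Re}\zeta,\operatorname{Im}\zeta,w)$; its asymptotic boundary is $\bar{\mathbb{C}}=\mathbb{C}\cup\{\infty\}$. Let $\Omega\subset\mathbb{C}$ be an open neighbourhood of $0$, $\Omega^*=\Omega\setminus\{0\}$, and let $E$ be a Bryant surface end (constant mean curvature $1$) given by an immersion $X=(\zeta,w):\Omega^*\to\mathbb{H}^3$ with Bryant representation $F=\begin{pmatrix}A&B\\C&D\end{pmatrix}$. That is, $A,B,C,D$ are holomorphic, possibly multivalued functions on $\Omega^*$ (single-valued holomorphic functions of $\log z$), with $AD-BC=1$ and $dA\,dD-dB\,dC=0$, and $$\zeta=\frac{\bar A C+\bar B D}{|A|^2+|B|^2},\qquad w=\frac{1}{|A|^2+|B|^2}$$ is a single-valued immersion on $\Omega^*$. Put $$\varphi_0=4\pi\operatorname{Res}_0(D\,dC-C\,dD),\quad \varphi_1=4\pi\operatorname{Res}_0(C\,dB-D\,dA),\quad \varphi_2=4\pi\operatorname{Res}_0(B\,dA-A\,dB),$$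 where these one-forms are single-valued on $\Omega^*$ and $\operatorname{Res}_0$ is $\frac{1}{2\pi i}$ times the integral over a small positively oriented circle about $0$. For a vector field $Y$ on $\mathbb{H}^3$, the flux of $Y$ through $E$ is $$\varphi=\int_\Gamma\langle\eta,Y\rangle-2\int_K\langle\nu,Y\rangle .$$ Here $\Gamma$ is the image under $X$ of a regular closed $C^2$ curve generating the fundamental group of a punctured disk $0<|z|<R$ contained in $\Omega$; $\eta$ is the unit conormal to $\Gamma$ in the direction of the end $z=0$; $\Gamma$ is oriented so that $(\Gamma,\eta,-\vec H)$ is direct, $\vec H$ being the mean curvature vector; $K$ is a disk ($C^2$ up to the boundary, not necessarily embedded) in $\mathbb{H}^3$ with boundary $\Gamma$; and $\nu$ is the unit normal to $K$ inducing this orientation on $\Gamma$. Let $\mathcal{C}\neq\mathcal{D}$ be points of $\bar{\mathbb{C}}$ and let $Y$ be the Killing field associated to the rotation about the oriented geodesic $(\mathcal{C},\mathcal{D})$ from $\mathcal C$ to $\mathcal D$, that is, $\frac{dR_\theta}{d\theta}=Y(R_\theta)$, where $R_\theta$ is the rotation of angle $\theta$, in the direct sense, about $(\mathcal{C},\mathcal{D})$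 (for $(0,\infty)$ it is $(\zeta,w)\mapsto(e^{i\theta}\zeta,w)$). Then such choices of $\Gamma,\eta,K$ exist, and for all of them the flux of $Y$ through $E$ is $$\varphi=-\operatorname{Im}\left(\frac{\varphi_2\,\mathcal{C}\mathcal{D}+\varphi_1(\mathcal{C}+\mathcal{D})+\varphi_0}{\mathcal{C}-\mathcal{D}}\right),$$ where for $\mathcal{D}=\infty$ the fraction means $-(\varphi_2\mathcal{C}+\varphi_1)$ and for $\mathcal{C}=\infty$ it means $\varphi_2\mathcal{D}+\varphi_1$. -/

import Mathlib

open Set Filter Topology MeasureTheory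
open scoped ComplexConjugate MatrixGroups

noncomputable section

namespace BryantFlux

/-! ### The upper half-space model

Points of hyperbolic space and tangent vectors are pairs `(ζ, w) : ℂ × ℝ`, with `ζ = u + i v`.
Hyperbolic space is the set `0 < w` with metric `(|dζ|² + dw²) / w²`, oriented by `(u, v, w)`. -/

/-- Hyperbolic space as a subset of `ℂ × ℝ`. -/
def upperHalf : Set (ℂ × ℝ) := {p | 0 < p.2}

/-- The Euclidean scalar product of two tangent vectors. -/
def eucInner (U V : ℂ × ℝ) : ℝ := (conj U.1 * V.1).re + U.2 * V.2

/-- The hyperbolic metric at the point `p`. -/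
def hypInner (p U V : ℂ × ℝ) : ℝ := eucInner U V / p.2 ^ 2

/-- The hyperbolic length of the tangent vector `U` at `p`. -/
def hypNorm (p U : ℂ × ℝ) : ℝ := √(hypInner p U U)

/-- The determinant of `(U, V, W)` in the coordinates `(u, v, w)`; the basis `(U, V, W)` is direct
if and only if it is positive. -/
def orientDet (U V W : ℂ × ℝ) : ℝ :=
  Matrix.det !![U.1.re, U.1.im, U.2; V.1.re, V.1.im, V.2; W.1.re, W.1.im, W.2]

/-- The Euclidean cross product. The model being conformal, `cross U V` is orthogonal to `U` and
`V` for the hyperbolic metric too, and `(U, V, cross U V)` is direct if `U, V` are independent. -/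
def cross (U V : ℂ × ℝ) : ℂ × ℝ :=
  (⟨U.1.im * V.2 - U.2 * V.1.im, U.2 * V.1.re - U.1.re * V.2⟩,
    U.1.re * V.1.im - U.1.im * V.1.re)

/-- For independent tangent vectors `U, V` at `p`: the vector of hyperbolic length `1`
orthogonal to `U` and `V` such that `(U, V, unitNormal p U V)` is direct. -/
def unitNormal (p U V : ℂ × ℝ) : ℂ × ℝ := (hypNorm p (cross U V))⁻¹ • cross U V

/-- The hyperbolic area of the parallelogram spanned by `U` and `V` at `p`. -/
def hypArea (p U V : ℂ × ℝ) : ℝ :=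
  √(hypInner p U U * hypInner p V V - hypInner p U V ^ 2)

/-- The Christoffel symbol of the Levi-Civita connection of the hyperbolic metric:
`∇_U V = D_U V + christoffel p U V` at `p`. -/
def christoffel (p U V : ℂ × ℝ) : ℂ × ℝ :=
  -(U.2 / p.2) • V - (V.2 / p.2) • U + (eucInner U V / p.2) • ((0, 1) : ℂ × ℝ)

/-- For a parametrized surface `X`: the covariant derivative, in the direction of `a`, of the
vector field `dX(b)` along `X`, at the parameter `z`. -/
def covDeriv₂ (X : ℂ → ℂ × ℝ) (z a b : ℂ) : ℂ × ℝ :=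
  fderiv ℝ (fun y => fderiv ℝ X y b) z a +
    christoffel (X z) (fderiv ℝ X z a) (fderiv ℝ X z b)

/-- The mean curvature vector of an immersed surface `X` at the parameter `z`: half the trace of
the second fundamental form (the normal part of `covDeriv₂`) with respect to the first. It does
not depend on the choice of a unit normal. -/
def meanCurvatureVector (X : ℂ → ℂ × ℝ) (z : ℂ) : ℂ × ℝ :=
  let U := fderiv ℝ X z 1
  let V := fderiv ℝ X z Complex.I
  let e := hypInner (X z) U U
  let f := hypInner (X z) U V
  let g := hypInner (X z) V V
  let T := (1 / (2 * (e * g - f ^ 2))) •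
    (g • covDeriv₂ X z 1 1 - (2 * f) • covDeriv₂ X z 1 Complex.I
      + e • covDeriv₂ X z Complex.I Complex.I)
  let N := unitNormal (X z) U V
  hypInner (X z) T N • N

/-! ### Bryant surface ends -/

/-- The point of the half-space model corresponding to the Hermitian matrix `N` of determinant `1`
and positive trace (a point of the Minkowski model). For `N = F F*` with rows `(A, B)`, `(C, D)` of
`F`, it is `ζ = (conj A * C + conj B * D) / (|A|² + |B|²)`, `w = 1 / (|A|² + |B|²)`. -/
def halfSpaceOfHermitian (N : Matrix (Fin 2) (Fin 2) ℂ) : ℂ × ℝ :=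
  (N 1 0 / N 0 0, 1 / (N 0 0).re)

/-- `X : Ω ∖ {0} → ℍ³` is a Bryant surface end with Bryant representation `F`. The Bryant
representation is a multivalued function of `z ∈ Ω ∖ {0}`; it is given in the logarithmic
coordinate, `F s` being a value of it over `z = exp s`. It is holomorphic with values in `SL₂(ℂ)`,
it satisfies `dA dD - dB dC = 0`, and `X = F F*` is a single-valued immersion on `Ω ∖ {0}`. -/
structure IsBryantEnd (Ω : Set ℂ) (X : ℂ → ℂ × ℝ) (F : ℂ → Matrix (Fin 2) (Fin 2) ℂ) : Prop where
  isOpen : IsOpen Ω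
  zero_mem : (0 : ℂ) ∈ Ω
  holomorphic : ∀ i j, DifferentiableOn ℂ (fun s => F s i j) (Complex.exp ⁻¹' Ω)
  det_eq_one : ∀ s, Complex.exp s ∈ Ω → (F s).det = 1
  null : ∀ s, Complex.exp s ∈ Ω →
    deriv (fun t => F t 0 0) s * deriv (fun t => F t 1 1) s
      - deriv (fun t => F t 0 1) s * deriv (fun t => F t 1 0) s = 0
  represents : ∀ s, Complex.exp s ∈ Ω →
    X (Complex.exp s) = halfSpaceOfHermitian (F s * (F s).conjTranspose)
  immersion : ∀ z ∈ Ω, z ≠ 0 → Function.Injective (fderiv ℝ X z)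

/-- The residue at `0` of `h(z) dz`, for `h` holomorphic in a punctured neighbourhood of `0`:
the value of `(2πi)⁻¹ ∮_{|z| = r} h(z) dz` for all small `r > 0`. -/
def residueAtZero (h : ℂ → ℂ) : ℂ :=
  limUnder (𝓝[>] (0 : ℝ))
    (fun r => (2 * Real.pi * Complex.I)⁻¹ * ∮ z in C(0, r), h z)

/-- The residue at `z = 0` of the one-form `u dv - u' dv'`, where `u, v, u', v'` are multivalued
functions given in the logarithmic coordinate `s` (`z = exp s`) and the form
`(u dv/ds - u' dv'/ds) ds` is single-valued in `z`. Since `ds = dz / z`, its coefficient with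
respect to `dz` is that with respect to `ds`, taken at any logarithm of `z`, divided by `z`. -/
def resForm (u v u' v' : ℂ → ℂ) : ℂ :=
  residueAtZero fun z =>
    (u (Complex.log z) * deriv v (Complex.log z)
      - u' (Complex.log z) * deriv v' (Complex.log z)) / z

/-- `φ₀ = 4π Res (D dC - C dD)`. -/
def phi₀ (F : ℂ → Matrix (Fin 2) (Fin 2) ℂ) : ℂ :=
  4 * Real.pi * resForm (fun s => F s 1 1) (fun s => F s 1 0) (fun s => F s 1 0) (fun s => F s 1 1)

/-- `φ₁ = 4π Res (C dB - D dA)`. -/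
def phi₁ (F : ℂ → Matrix (Fin 2) (Fin 2) ℂ) : ℂ :=
  4 * Real.pi * resForm (fun s => F s 1 0) (fun s => F s 0 1) (fun s => F s 1 1) (fun s => F s 0 0)

/-- `φ₂ = 4π Res (B dA - A dB)`. -/
def phi₂ (F : ℂ → Matrix (Fin 2) (Fin 2) ℂ) : ℂ :=
  4 * Real.pi * resForm (fun s => F s 0 1) (fun s => F s 0 0) (fun s => F s 0 0) (fun s => F s 0 1)

/-- `(φ₂ 𝒞𝒟 + φ₁ (𝒞 + 𝒟) + φ₀) / (𝒞 - 𝒟)` for distinct `𝒞, 𝒟` in the Riemann sphere; if one of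
them is `∞`, it is the limit of the expression as that point tends to `∞`. -/
def endpointQuotient (φ₀ φ₁ φ₂ : ℂ) (𝒞 𝒟 : OnePoint ℂ) : ℂ :=
  𝒞.elim
    (𝒟.elim 0 fun d => φ₂ * d + φ₁)
    (fun c => 𝒟.elim (-(φ₂ * c + φ₁)) fun d => (φ₂ * c * d + φ₁ * (c + d) + φ₀) / (c - d))

/-! ### Rotations and their Killing fields -/

/-- The direct isometry of the half-space model defined by `P ∈ SL₂(ℂ)`: the extension to `ℍ³` of
the Möbius transformation `ζ ↦ (a ζ + b) / (c ζ + d)` of the Riemann sphere. -/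
def isometryOf (P : SL(2, ℂ)) (p : ℂ × ℝ) : ℂ × ℝ :=
  let q : ℂ := P 1 0 * p.1 + P 1 1
  let m : ℝ := Complex.normSq q + Complex.normSq (P 1 0) * p.2 ^ 2
  (((P 0 0 * p.1 + P 0 1) * conj q + P 0 0 * conj (P 1 0) * (p.2 : ℂ) ^ 2) / (m : ℂ), p.2 / m)

/-- The rotation of angle `θ`, in the direct sense, about the oriented geodesic `(0, ∞)`. -/
def axisRotation (θ : ℝ) (p : ℂ × ℝ) : ℂ × ℝ := (Complex.exp (θ * Complex.I) * p.1, p.2)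

/-- `Y` is, on `ℍ³`, the Killing field associated to the rotation about the oriented geodesic
`(𝒞, 𝒟)`, that is `dR_θ/dθ = Y(R_θ)`. Here the rotation `R_θ` of angle `θ` about `(𝒞, 𝒟)` is the
conjugate of the rotation about `(0, ∞)` by any direct isometry mapping `0` to `𝒞` and
`∞` to `𝒟`. -/
def IsRotationKillingField (𝒞 𝒟 : OnePoint ℂ) (Y : ℂ × ℝ → ℂ × ℝ) : Prop :=
  ∃ P : SL(2, ℂ),
    (P : GL (Fin 2) ℂ) • ((0 : ℂ) : OnePoint ℂ) = 𝒞 ∧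
    (P : GL (Fin 2) ℂ) • (OnePoint.infty : OnePoint ℂ) = 𝒟 ∧
    ∀ p ∈ upperHalf, ∀ θ : ℝ,
      HasDerivAt (fun θ' : ℝ => isometryOf P (axisRotation θ' (isometryOf P⁻¹ p)))
        (Y (isometryOf P (axisRotation θ (isometryOf P⁻¹ p)))) θ

/-! ### The flux -/

/-- The choices made to compute the flux through the end `X : Ω ∖ {0} → ℍ³`:
* a regular closed curve `Γ = X ∘ γ`, where `γ` (of period `2π`) generates, with one of the two
  orientations `ε = ±1`, the fundamental group of a punctured disk `0 < |z| < R` contained in `Ω`;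
* the unit conormal `η` to `Γ`, pointing in the direction of the end: `η = dX(v)` with `v` on the
  side of `γ` on which the puncture lies (the left if `γ` runs counterclockwise, else the right);
* the orientation of `Γ`, for which `(Γ, η, -H)` is direct, `H` being the mean curvature vector;
* a disk `K`, parametrized by `κ` on the closed unit disk, whose oriented boundary is `Γ`. -/
structure IsFluxChoice (Ω : Set ℂ) (X : ℂ → ℂ × ℝ) (ε : ℤ) (γ : ℝ → ℂ) (η : ℝ → ℂ × ℝ)
    (κ : ℂ → ℂ × ℝ) : Prop where
  sign : ε = 1 ∨ ε = -1
  generator : ∃ σ : ℝ → ℂ, ContDiff ℝ 2 σ ∧ (∀ t, γ t = Complex.exp (σ t)) ∧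
    ∀ t, σ (t + 2 * Real.pi) = σ t + ε * (2 * Real.pi * Complex.I)
  disk : ∃ R : ℝ, Metric.ball 0 R ⊆ Ω ∧ ∀ t, ‖γ t‖ < R
  regular : ∀ t, deriv γ t ≠ 0
  conormal_unit : ∀ t, hypNorm (X (γ t)) (η t) = 1
  conormal_orthogonal : ∀ t, hypInner (X (γ t)) (η t) (deriv (fun τ => X (γ τ)) t) = 0
  conormal_toward_end : ∀ t, ∃ v : ℂ, η t = fderiv ℝ X (γ t) v ∧
    0 < ε * (conj (deriv γ t) * v).im
  orientation : ∀ t,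
    0 < orientDet (deriv (fun τ => X (γ τ)) t) (η t) (-meanCurvatureVector X (γ t))
  disk_smooth : ContDiffOn ℝ 2 κ (Metric.closedBall 0 1)
  disk_mem : MapsTo κ (Metric.closedBall 0 1) upperHalf
  disk_boundary : ∀ t : ℝ, κ (Complex.exp (t * Complex.I)) = X (γ t)

/-- `∫_Γ ⟨η, Y⟩ - 2 ∫_K ⟨ν, Y⟩`, where `ν` is the unit normal to `K` such that the orientation of
`K` defined by `ν` induces on the boundary `Γ` the orientation given by increasing `t`. -/
def fluxIntegral (X : ℂ → ℂ × ℝ) (Y : ℂ × ℝ → ℂ × ℝ) (γ : ℝ → ℂ) (η : ℝ → ℂ × ℝ)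
    (κ : ℂ → ℂ × ℝ) : ℝ :=
  (∫ t in (0 : ℝ)..(2 * Real.pi),
      hypInner (X (γ t)) (η t) (Y (X (γ t))) * hypNorm (X (γ t)) (deriv (fun τ => X (γ τ)) t))
    - 2 * ∫ z in Metric.ball (0 : ℂ) 1,
      hypInner (κ z) (unitNormal (κ z) (fderiv ℝ κ z 1) (fderiv ℝ κ z Complex.I)) (Y (κ z))
        * hypArea (κ z) (fderiv ℝ κ z 1) (fderiv ℝ κ z Complex.I)

/-- The flux of the Killing field `Y` through the end `X : Ω ∖ {0} → ℍ³` is the number `φ`: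
the choices above are possible, and all of them give the value `φ`. -/
def HasFlux (Ω : Set ℂ) (X : ℂ → ℂ × ℝ) (Y : ℂ × ℝ → ℂ × ℝ) (φ : ℝ) : Prop :=
  (∃ ε γ η κ, IsFluxChoice Ω X ε γ η κ) ∧
    ∀ ε γ η κ, IsFluxChoice Ω X ε γ η κ → fluxIntegral X Y γ η κ = φ

end BryantFlux

end

open BryantFlux

noncomputable section

namespace BryantFlux

/-! ### Killing fields in coordinates -/

/-! Identify `ℍ³` with the positive Hermitian matrices N of determinant one. A traceless matrix y
moves N with velocity yN + Ny*, which is the field `killing`. Since X = FF*, the derivative of X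
along h is the value at X of the Killing field of y(h), where y = dF F⁻¹ is traceless and complex
linear in h (`hasDerivAt_halfSpaceOfHermitian`, `IsBryantEnd.fderiv_eq_killing`). Although F is
multivalued, y is not: the values at one point of the fields of all complex multiples of y determine
y (`killing_coeff_unique`).

The condition dA dD - dB dC = 0 says that y is nilpotent. Hence X is conformal, and turning a
tangent vector by a right angle amounts to replacing h by ih. The mean curvature vector H makes
(X_u, X_v, H) direct, so the prescribed orientation forces the parameter curve γ to run clockwise,
and the conormal satisfies |Γ'| η = -dX(iγ').

The algebraic heart is `hypInner_killing_I_mul`. If Y is generated by y' and α is its `primForm`,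
then ⟨dX(ih), Y⟩ = -α(dX(h)) - 2 Im tr(y' y(h)). As dα is twice the contraction of the volume form
with Y (`fderiv_primForm_sub`), Stokes' theorem makes the integral of α over Γ cancel the disk term.
There remains 2 Im ∫ tr(y' dF F⁻¹), the integral of a single-valued holomorphic form, which is a
combination of the three residues.

For a rotation about (P(0), P(∞)), y' is P diag(i/2, -i/2) P⁻¹ with the two basis vectors exchanged,
because ζ is N₁₀/N₀₀. Its entries are quadratic in those of P, and `endpointQuotient_eq` expresses
the resulting combination through the endpoints. -/

/-- The Killing field of `ℍ³` generated by the traceless matrix `y` with rows `(a, b)`, `(c, -a)`,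
acting on Hermitian matrices by `N ↦ y N + N y*`. -/
def killing (a b c : ℂ) (p : ℂ × ℝ) : ℂ × ℝ :=
  (c - 2 * a * p.1 - b * p.1 ^ 2 + conj b * (p.2 : ℂ) ^ 2, -2 * (a + b * p.1).re * p.2)

/-- The derivative of `killing a b c` at `p` in the direction of `U`. -/
def killingDeriv (a b : ℂ) (p U : ℂ × ℝ) : ℂ × ℝ :=
  (-2 * a * U.1 - 2 * b * p.1 * U.1 + 2 * conj b * p.2 * U.2,
    -2 * (b * U.1).re * p.2 - 2 * (a + b * p.1).re * U.2)

/-- The one-form `Im tr (N⁻¹ dN y*)` on `ℍ³`, for `y` as in `killing`; half of it is a primitive of the interior product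
of the volume form with `killing a b c`. -/
def primForm (a b c : ℂ) (p : ℂ × ℝ) : (ℂ × ℝ) →L[ℝ] ℝ :=
  Complex.imCLM ∘L (((conj c - 2 * conj a * conj p.1 - conj b * conj p.1 ^ 2) / (p.2 : ℂ) ^ 2 - b) •
      ContinuousLinearMap.fst ℝ ℂ ℝ)
    + (-2 * (conj a + conj b * conj p.1) / (p.2 : ℂ)).im • ContinuousLinearMap.snd ℝ ℂ ℝ

theorem primForm_apply (a b c : ℂ) (p U : ℂ × ℝ) :
    primForm a b c p U =
      (((conj c - 2 * conj a * conj p.1 - conj b * conj p.1 ^ 2) / (p.2 : ℂ) ^ 2 - b) * U.1).im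
        + (-2 * (conj a + conj b * conj p.1) / (p.2 : ℂ)).im * U.2 := by
  simp [primForm]

/-! ### Pointwise identities for Killing fields: metric, conformality, second derivatives. -/

/-- In the Hermitian model ⟨V, V'⟩ = ½ tr(N⁻¹V N⁻¹V'). Putting V = i(yN - Ny*) and V' = y'N + Ny'*,
the four traces pair into conjugates and give -Im tr(yy') - Im tr(N⁻¹yNy'*). Since `primForm` of y'
on yN + Ny* is Im tr(N⁻¹yNy'*) - Im tr(yy'), the correction is -2 Im tr(yy'). -/
theorem hypInner_killing_I_mul (a b c a' b' c' : ℂ) {p : ℂ × ℝ} (hp : p.2 ≠ 0) :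
    hypInner p (killing (a * Complex.I) (b * Complex.I) (c * Complex.I) p) (killing a' b' c' p) =
      -primForm a' b' c' p (killing a b c p) - 2 * (2 * a' * a + b' * c + c' * b).im := by
  obtain ⟨⟨x, y⟩, w⟩ := p
  have hw : w ≠ 0 := hp
  rw [primForm_apply]
  simp only [hypInner, eucInner, killing]
  simp [pow_two, ← Complex.ofReal_mul, Complex.div_ofReal_im, Complex.div_ofReal_re]
  field_simp
  ring

/-- The field depends on its matrix only real linearly, because of the term in `conj b`; complex
multiples therefore need both the matrix and its product with i. -/
theorem killing_mul (a b c h : ℂ) (p : ℂ × ℝ) :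
    killing (a * h) (b * h) (c * h) p =
      h.re • killing a b c p +
        h.im • killing (a * Complex.I) (b * Complex.I) (c * Complex.I) p := by
  obtain ⟨⟨x, y⟩, w⟩ := p
  refine Prod.ext (Complex.ext ?_ ?_) ?_ <;>
  simp [killing, pow_two, ← Complex.ofReal_mul] <;> ring

/-- The inner product of the fields of y and y' is Re tr(yy') + Re tr(N⁻¹yNy'*). For nilpotent y the
first term vanishes on multiples of y, and the second is the real part of a Hermitian form, for
which y and iy are orthogonal and of equal length. -/
theorem eucInner_killing_I {a b c : ℂ} (hn : a ^ 2 + b * c = 0) (p : ℂ × ℝ) :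
    eucInner (killing a b c p)
      (killing (a * Complex.I) (b * Complex.I) (c * Complex.I) p) = 0 := by
  obtain ⟨⟨x, y⟩, w⟩ := p
  have h2 := congrArg Complex.im hn
  simp [pow_two] at h2
  simp only [eucInner, killing]
  simp [pow_two, ← Complex.ofReal_mul]
  linear_combination (-2 * w ^ 2) * h2

theorem eucInner_killing_I_I {a b c : ℂ} (hn : a ^ 2 + b * c = 0) (p : ℂ × ℝ) :
    eucInner (killing (a * Complex.I) (b * Complex.I) (c * Complex.I) p)
      (killing (a * Complex.I) (b * Complex.I) (c * Complex.I) p) =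
    eucInner (killing a b c p) (killing a b c p) := by
  obtain ⟨⟨x, y⟩, w⟩ := p
  have h1 := congrArg Complex.re hn
  simp [pow_two] at h1
  simp only [eucInner, killing]
  simp [pow_two, ← Complex.ofReal_mul]
  linear_combination (-4 * w ^ 2) * h1

/-- Null curves of Killing fields define conformal maps. -/
theorem hypInner_killing_mul {a b c : ℂ} (hn : a ^ 2 + b * c = 0) (h k : ℂ) (p : ℂ × ℝ) :
    hypInner p (killing (a * h) (b * h) (c * h) p) (killing (a * k) (b * k) (c * k) p) =
      hypInner p (killing a b c p) (killing a b c p) * (conj h * k).re := by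
  have h1 := eucInner_killing_I hn p
  have h2 := eucInner_killing_I_I hn p
  rw [killing_mul a b c h, killing_mul a b c k]
  generalize killing a b c p = U at *
  generalize killing (a * Complex.I) (b * Complex.I) (c * Complex.I) p = V at *
  simp [hypInner, eucInner] at h1 h2 ⊢
  rw [← sub_eq_zero, div_mul_eq_mul_div, ← sub_div]
  refine div_eq_zero_iff.2 (Or.inl ?_)
  linear_combination (h.re * k.im + h.im * k.re) * h1 + h.im * k.im * h2

theorem orientDet_killing_mul (a b c h k : ℂ) (p W : ℂ × ℝ) :
    orientDet (killing (a * h) (b * h) (c * h) p) (killing (a * k) (b * k) (c * k) p) W =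
      (conj h * k).im * orientDet (killing a b c p)
        (killing (a * Complex.I) (b * Complex.I) (c * Complex.I) p) W := by
  rw [killing_mul a b c h, killing_mul a b c k]
  generalize killing a b c p = U
  generalize killing (a * Complex.I) (b * Complex.I) (c * Complex.I) p = V
  simp [orientDet, Matrix.det_fin_three]
  ring

/-- The equation of surfaces of mean curvature one, for the null curves of Killing fields. -/
theorem killingDeriv_add_christoffel (a b c : ℂ) {p : ℂ × ℝ} (hp : p.2 ≠ 0) :
    killingDeriv a b p (killing a b c p) +
        christoffel p (killing a b c p) (killing a b c p) +
      (killingDeriv (a * Complex.I) (b * Complex.I) p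
          (killing (a * Complex.I) (b * Complex.I) (c * Complex.I) p) +
        christoffel p (killing (a * Complex.I) (b * Complex.I) (c * Complex.I) p)
          (killing (a * Complex.I) (b * Complex.I) (c * Complex.I) p)) =
      (2 / p.2) • cross (killing a b c p)
        (killing (a * Complex.I) (b * Complex.I) (c * Complex.I) p) := by
  obtain ⟨⟨x, y⟩, w⟩ := p
  have hw : w ≠ 0 := hp
  refine Prod.ext (Complex.ext ?_ ?_) ?_ <;>
  simp [killing, killingDeriv, christoffel, cross, eucInner, pow_two, ← Complex.ofReal_mul] <;>
  field_simp <;> ring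

/-! ### Cross product, unit normal and area. -/

theorem orientDet_smul_cross (U V : ℂ × ℝ) (r : ℝ) :
    orientDet U V (r • cross U V) = r * eucInner (cross U V) (cross U V) := by
  simp [orientDet, Matrix.det_fin_three, cross, eucInner]
  ring

theorem eucInner_cross (U V W : ℂ × ℝ) : eucInner W (cross U V) = orientDet U V W := by
  simp [orientDet, Matrix.det_fin_three, cross, eucInner]
  ring

theorem eucInner_self_pos {U : ℂ × ℝ} (h : U ≠ 0) : 0 < eucInner U U := by
  obtain ⟨⟨x, y⟩, w⟩ := U
  have : x ≠ 0 ∨ y ≠ 0 ∨ w ≠ 0 := by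
    by_contra! hh
    exact h (by simp [hh, Complex.ext_iff])
  simp only [eucInner, Complex.mul_re, Complex.conj_re, Complex.conj_im]
  rcases this with h | h | h <;> nlinarith [mul_self_pos.2 h, mul_self_nonneg x, mul_self_nonneg y,
    mul_self_nonneg w]

theorem hypInner_self_pos {p U : ℂ × ℝ} (hp : p.2 ≠ 0) (h : U ≠ 0) : 0 < hypInner p U U :=
  div_pos (eucInner_self_pos h) (by positivity)

/-- Only the normal part of a vector matters for the side of the plane on which it lies. This
reduces the sign of the mean curvature vector to that of the trace of the second derivatives. -/
theorem orientDet_normal_pos {p U V T : ℂ × ℝ} (hp : p.2 ≠ 0) (hT : 0 < orientDet U V T) :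
    0 < orientDet U V (hypInner p T (unitNormal p U V) • unitNormal p U V) := by
  have hc : cross U V ≠ 0 := by
    intro h
    rw [← eucInner_cross, h] at hT
    simp [eucInner] at hT
  have h1 : 0 < hypInner p (cross U V) (cross U V) := hypInner_self_pos hp hc
  have h2 : 0 < (hypNorm p (cross U V))⁻¹ := inv_pos.2 (Real.sqrt_pos.2 h1)
  rw [unitNormal, smul_smul, orientDet_smul_cross]
  refine mul_pos (mul_pos ?_ h2) (eucInner_self_pos hc)
  have : hypInner p T ((hypNorm p (cross U V))⁻¹ • cross U V) =
      (hypNorm p (cross U V))⁻¹ * (orientDet U V T / p.2 ^ 2) := by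
    rw [← eucInner_cross]
    generalize cross U V = Z
    simp [hypInner, eucInner]
    ring
  rw [this]
  positivity

/-- The length of the cross product cancels between the normal and the area, leaving the volume
form. Dependent U, V are allowed, both sides then being zero; this matters because the disk need not
be immersed. -/
theorem hypInner_unitNormal_mul_hypArea {p : ℂ × ℝ} (hp : 0 < p.2) (U V W : ℂ × ℝ) :
    hypInner p (unitNormal p U V) W * hypArea p U V = orientDet U V W / p.2 ^ 3 := by
  have hA : hypArea p U V = √(eucInner (cross U V) (cross U V)) / p.2 ^ 2 := by
    rw [hypArea]
    have : hypInner p U U * hypInner p V V - hypInner p U V ^ 2 =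
        eucInner (cross U V) (cross U V) / (p.2 ^ 2) ^ 2 := by
      simp [hypInner, eucInner, cross]
      field_simp
      ring
    rw [this, Real.sqrt_div' _ (by positivity), Real.sqrt_sq (by positivity)]
  have hN : hypNorm p (cross U V) = √(eucInner (cross U V) (cross U V)) / p.2 := by
    rw [hypNorm, hypInner, Real.sqrt_div' _ (by positivity), Real.sqrt_sq hp.le]
  have hI : hypInner p (unitNormal p U V) W =
      (hypNorm p (cross U V))⁻¹ * (orientDet U V W / p.2 ^ 2) := by
    rw [← eucInner_cross, unitNormal]
    generalize cross U V = Z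
    simp [hypInner, eucInner]
    ring
  rw [hI, hA, hN]
  by_cases hc : cross U V = 0
  · rw [← eucInner_cross, hc]
    simp [eucInner]
  · have := Real.sqrt_pos.2 (eucInner_self_pos hc)
    field_simp

/-! ### Isometries of the half-space and the Killing fields of rotations. -/

theorem isometry_denom_pos {a b c d ζ : ℂ} {w : ℝ} (hdet : a * d - b * c = 1) (hw : 0 < w) :
    0 < Complex.normSq (c * ζ + d) + Complex.normSq c * w ^ 2 := by
  by_cases hc : c = 0
  · have hd : c * ζ + d ≠ 0 := by
      rintro h
      simp only [hc, zero_mul, zero_add] at h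
      simp [hc, h] at hdet
    have := Complex.normSq_pos.2 hd
    have := Complex.normSq_nonneg c
    positivity
  · have := Complex.normSq_pos.2 hc
    have := Complex.normSq_nonneg (c * ζ + d)
    positivity

theorem isometryOf_isometryOf_inv (P : SL(2, ℂ)) {p : ℂ × ℝ} (hp : p ∈ upperHalf) :
    isometryOf P (isometryOf P⁻¹ p) = p := by
  obtain ⟨ζ, w⟩ := p
  have hw : 0 < w := hp
  have hdet : P 0 0 * P 1 1 - P 0 1 * P 1 0 = 1 := by
    rw [← Matrix.det_fin_two]; exact P.2
  have e00 : P⁻¹ 0 0 = P 1 1 := by simp [Matrix.SpecialLinearGroup.SL2_inv_expl]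
  have e01 : P⁻¹ 0 1 = -P 0 1 := by simp [Matrix.SpecialLinearGroup.SL2_inv_expl]
  have e10 : P⁻¹ 1 0 = -P 1 0 := by simp [Matrix.SpecialLinearGroup.SL2_inv_expl]
  have e11 : P⁻¹ 1 1 = P 0 0 := by simp [Matrix.SpecialLinearGroup.SL2_inv_expl]
  simp only [isometryOf, e00, e01, e10, e11]
  generalize P 0 0 = a at *
  generalize P 0 1 = b at *
  generalize P 1 0 = c at *
  generalize P 1 1 = d at *
  set q : ℂ := -c * ζ + a with hq
  set m : ℝ := Complex.normSq q + Complex.normSq (-c) * w ^ 2 with hm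
  have hmpos : 0 < m := isometry_denom_pos (a := d) (b := -b)
    (by linear_combination hdet) hw
  have hmC : (m : ℂ) = q * conj q + c * conj c * (w : ℂ) ^ 2 := by
    rw [hm]; push_cast; rw [Complex.normSq_neg, ← Complex.mul_conj, ← Complex.mul_conj]
  have hm0 : (m : ℂ) ≠ 0 := by exact_mod_cast hmpos.ne'
  have h1 : c * (((d * ζ + -b) * conj q + d * conj (-c) * (w : ℂ) ^ 2) / (m : ℂ)) + d =
      conj q / m := by
    field_simp
    rw [hmC, hq, map_neg]
    linear_combination (conj (-c * ζ + a)) * hdet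
  have h2 : a * (((d * ζ + -b) * conj q + d * conj (-c) * (w : ℂ) ^ 2) / (m : ℂ)) + b =
      (conj q * ζ - conj c * (w : ℂ) ^ 2) / m := by
    field_simp
    rw [hmC, hq, map_neg]
    linear_combination (conj (-c * ζ + a) * ζ - conj c * (w : ℂ) ^ 2) * hdet
  have h3 : Complex.normSq (conj q / m) + Complex.normSq c * (w / m) ^ 2 = 1 / m := by
    rw [Complex.normSq_div, Complex.normSq_conj, Complex.normSq_ofReal]
    rw [Complex.normSq_neg] at hm
    field_simp
    linarith
  rw [h1, h2, h3]
  refine Prod.ext ?_ ?_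
  · simp only [map_div₀, Complex.conj_conj, Complex.conj_ofReal]
    push_cast
    field_simp
    have : a = q + c * ζ := by rw [hq]; ring
    rw [hmC, this]
    ring
  · field_simp

theorem isometryOf_mem_upperHalf (P : SL(2, ℂ)) {p : ℂ × ℝ} (hp : p ∈ upperHalf) :
    isometryOf P p ∈ upperHalf := by
  have hdet : P 0 0 * P 1 1 - P 0 1 * P 1 0 = 1 := by
    rw [← Matrix.det_fin_two]; exact P.2
  exact div_pos hp (isometry_denom_pos hdet hp)

/-- The Killing field of the conjugate by `P` of the rotation about `(0, ∞)`. -/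
theorem hasDerivAt_isometryOf_axisRotation (P : SL(2, ℂ)) {p : ℂ × ℝ} (hp : p ∈ upperHalf) :
    HasDerivAt (fun θ : ℝ => isometryOf P (axisRotation θ p))
      (killing (-(Complex.I / 2) * (P 0 0 * P 1 1 + P 0 1 * P 1 0)) (Complex.I * (P 1 0 * P 1 1))
        (-Complex.I * (P 0 0 * P 0 1)) (isometryOf P p)) 0 := by
  obtain ⟨ζ, w⟩ := p
  have hw : 0 < w := hp
  have hdet : P 0 0 * P 1 1 - P 0 1 * P 1 0 = 1 := by
    rw [← Matrix.det_fin_two]; exact P.2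
  have hz : HasDerivAt (fun θ : ℝ => Complex.exp (θ * Complex.I) * ζ) (Complex.I * ζ) 0 := by
    have := ((((hasDerivAt_id (0 : ℝ)).ofReal_comp).mul_const Complex.I).cexp).mul_const ζ
    simpa using this
  have hzc : HasDerivAt (fun θ : ℝ => conj (Complex.exp (θ * Complex.I) * ζ))
      (conj (Complex.I * ζ)) 0 := by
    exact (Complex.conjCLE.toContinuousLinearMap.hasFDerivAt.comp_hasDerivAt (0 : ℝ) hz)
  simp only [isometryOf, axisRotation]
  generalize P 0 0 = a at *
  generalize P 0 1 = b at *
  generalize P 1 0 = c at *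
  generalize P 1 1 = d at *
  have hmpos := isometry_denom_pos (ζ := ζ) hdet hw
  have hnormSq : ∀ z : ℂ, Complex.normSq z = (z * conj z).re := fun z => by
    rw [Complex.mul_conj, Complex.ofReal_re]
  have hQ := (hz.const_mul c).add_const d
  have hQc := (hzc.const_mul (conj c)).add_const (conj d)
  have hm : HasDerivAt (fun θ : ℝ => Complex.normSq (c * (Complex.exp (θ * Complex.I) * ζ) + d) +
      Complex.normSq c * w ^ 2)
      (c * (Complex.I * ζ) * (conj c * conj ζ + conj d) +
        (c * ζ + d) * (conj c * conj (Complex.I * ζ))).re 0 := by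
    have h := ((Complex.reCLM.hasFDerivAt.comp_hasDerivAt (0 : ℝ) (hQ.mul hQc)).add_const
      (Complex.normSq c * w ^ 2))
    refine (h.congr_of_eventuallyEq (Eventually.of_forall fun θ => ?_)).congr_deriv ?_
    · simp only [Function.comp, Complex.reCLM_apply, Pi.mul_apply]
      rw [hnormSq (c * _ + d), map_add, map_mul]
    · simp
  have hN : HasDerivAt (fun θ : ℝ =>
      (a * (Complex.exp (θ * Complex.I) * ζ) + b) *
          conj (c * (Complex.exp (θ * Complex.I) * ζ) + d) + a * conj c * (w : ℂ) ^ 2)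
      (a * (Complex.I * ζ) * (conj c * conj ζ + conj d) +
        (a * ζ + b) * (conj c * conj (Complex.I * ζ))) 0 := by
    have h := ((((hz.const_mul a).add_const b).mul hQc).add_const (a * conj c * (w : ℂ) ^ 2))
    refine (h.congr_of_eventuallyEq (Eventually.of_forall fun θ => ?_)).congr_deriv ?_
    · simp
    · simp
  have hm0 : Complex.normSq (c * (Complex.exp ((0 : ℝ) * Complex.I) * ζ) + d) +
      Complex.normSq c * w ^ 2 ≠ 0 := by simpa using hmpos.ne'
  refine ((hN.div hm.ofReal_comp (by exact_mod_cast hm0)).prodMk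
    ((hasDerivAt_const (0 : ℝ) w).div hm hm0)).congr_deriv ?_
  simp only [Complex.ofReal_zero, zero_mul, Complex.exp_zero, one_mul]
  set m : ℝ := Complex.normSq (c * ζ + d) + Complex.normSq c * w ^ 2 with hm_def
  have hmC : (m : ℂ) = (c * ζ + d) * (conj c * conj ζ + conj d) + c * conj c * (w : ℂ) ^ 2 := by
    rw [hm_def]
    push_cast
    rw [← Complex.mul_conj, ← Complex.mul_conj, map_add, map_mul]
  have hmne : (m : ℂ) ≠ 0 := by exact_mod_cast hmpos.ne'
  -- The derivative of the real denominator is self-conjugate, so its real part can be replaced by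
  -- the complex expression itself, and the identity becomes rational.
  have key1 : ∀ r : ℂ, r = (c * (Complex.I * ζ) * (conj c * conj ζ + conj d) +
      (c * ζ + d) * (conj c * conj (Complex.I * ζ))) → (r.re : ℂ) = r := by
    intro r hr
    rw [← Complex.conj_eq_iff_re, hr]
    simp
    ring
  refine Prod.ext ?_ ?_
  · simp only [killing]
    rw [key1 _ rfl]
    simp only [map_mul, map_add, Complex.conj_I]
    push_cast
    field_simp
    rw [hmC]
    linear_combination (-((a * ζ * (conj c * conj ζ + conj d) - conj c * conj ζ * (a * ζ + b)) *
        ((c * ζ + d) * (conj c * conj ζ + conj d) + c * conj c * (w : ℂ) ^ 2) -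
      ((conj c * conj ζ + conj d) * (a * ζ + b) + a * conj c * (w : ℂ) ^ 2) *
        (ζ * (conj c * conj ζ + conj d) * c - conj c * conj ζ * (ζ * c + d))) -
      conj c * conj d * (w : ℂ) ^ 2 * (1 + (a * d - b * c))) * hdet
  · simp only [killing]
    have : -(Complex.I / 2) * (a * d + b * c) + Complex.I * (c * d) *
      (((a * ζ + b) * conj (c * ζ + d) + a * conj c * (w : ℂ) ^ 2) / m) =
      Complex.I * (1 / 2 - d * conj (c * ζ + d) / m) := by
      field_simp
      rw [hmC, map_add, map_mul]
      linear_combination ((c * ζ + d) * (conj c * conj ζ + conj d) + c * conj c * (w : ℂ) ^ 2 -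
        2 * d * (conj c * conj ζ + conj d)) * hdet
    rw [this]
    simp
    field_simp
    ring

/-- The orbit equation at θ = 0 already determines Y: every p of the half-space starts an orbit, and
the derivative is unique. -/
theorem IsRotationKillingField.exists_killing {𝒞 𝒟 : OnePoint ℂ} {Y : ℂ × ℝ → ℂ × ℝ}
    (hY : IsRotationKillingField 𝒞 𝒟 Y) :
    ∃ a b c d : ℂ, a * d - b * c = 1 ∧ 𝒞 = (if d = 0 then OnePoint.infty else (b / d : ℂ)) ∧
      𝒟 = (if c = 0 then OnePoint.infty else (a / c : ℂ)) ∧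
      ∀ p ∈ upperHalf, Y p = killing (-(Complex.I / 2) * (a * d + b * c)) (Complex.I * (c * d))
        (-Complex.I * (a * b)) p := by
  obtain ⟨P, h0, hinf, hder⟩ := hY
  refine ⟨P 0 0, P 0 1, P 1 0, P 1 1, ?_, ?_, ?_, fun p hp => ?_⟩
  · rw [← Matrix.det_fin_two]; exact P.2
  · rw [← h0, OnePoint.smul_some_eq_ite]
    simp
  · rw [← hinf, OnePoint.smul_infty_eq_ite]
    by_cases h : P 1 0 = 0 <;> simp [h]
  · have h1 := hder p hp 0
    have h2 := hasDerivAt_isometryOf_axisRotation P (isometryOf_mem_upperHalf P⁻¹ hp)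
    have h3 : axisRotation 0 (isometryOf P⁻¹ p) = isometryOf P⁻¹ p := by
      simp [axisRotation]
    rw [h3, isometryOf_isometryOf_inv P hp] at h1
    rw [isometryOf_isometryOf_inv P hp] at h2
    exact h1.unique h2

/-! ### Green's and Stokes' theorems on the closed unit disk. -/

/-- **Green's theorem** on the unit disk. -/
theorem integral_ball_curl (ω : ℂ → ℂ →L[ℝ] ℝ) (hω : ContDiffOn ℝ 1 ω (Metric.closedBall 0 1)) :
    ∫ z in Metric.ball (0 : ℂ) 1, (fderiv ℝ ω z 1 Complex.I - fderiv ℝ ω z Complex.I 1) =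
      ∫ t in (0 : ℝ)..(2 * Real.pi),
        ω (Complex.exp (t * Complex.I)) (Complex.I * Complex.exp (t * Complex.I)) := by
  set B := Metric.closedBall (0 : ℂ) 1 with hB
  have hpi := Real.pi_pos
  have hBu : UniqueDiffOn ℝ B := uniqueDiffOn_convex (convex_closedBall _ _)
    ⟨0, by rw [interior_closedBall _ one_ne_zero]; simp⟩
  have hDW : ContinuousOn (fderivWithin ℝ ω B) B := hω.continuousOn_fderivWithin hBu le_rfl
  -- The form is only controlled on the closed disk, so the derivative within it supplies a curl
  -- that is continuous up to the boundary; it agrees with the ordinary one in the interior.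
  set D : ℂ → ℝ := fun z =>
    fderivWithin ℝ ω B z 1 Complex.I - fderivWithin ℝ ω B z Complex.I 1 with hD
  have hDc : ContinuousOn D B :=
    ((hDW.clm_apply continuousOn_const).clm_apply continuousOn_const).sub
      ((hDW.clm_apply continuousOn_const).clm_apply continuousOn_const)
  set e : ℝ × ℝ → ℂ := fun x => Complex.exp (x.2 * Complex.I) with he
  set P : ℝ × ℝ → ℂ := fun x => x.1 * e x with hP
  have hec : Continuous e := by fun_prop
  have hPc : Continuous P := by fun_prop
  have hnorm : ∀ x, ‖e x‖ = 1 := fun x => Complex.norm_exp_ofReal_mul_I _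
  have hPB : MapsTo P (Icc 0 1 ×ˢ Icc (-Real.pi) Real.pi) B := by
    rintro x ⟨⟨h0, h1⟩, -⟩
    simpa [hB, P, hnorm, abs_of_nonneg h0] using h1
  set e' : ℝ × ℝ → (ℝ × ℝ) →L[ℝ] ℂ := fun x =>
    e x • (Complex.ofRealCLM ∘L ContinuousLinearMap.snd ℝ ℝ ℝ).smulRight Complex.I with he'
  have hde : ∀ x, HasFDerivAt e (e' x) x := by
    intro x
    have h2 : HasFDerivAt (fun x : ℝ × ℝ => (x.2 : ℂ))
      (Complex.ofRealCLM ∘L ContinuousLinearMap.snd ℝ ℝ ℝ) x :=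
      (Complex.ofRealCLM ∘L ContinuousLinearMap.snd ℝ ℝ ℝ).hasFDerivAt
    refine (h2.mul_const Complex.I).cexp.congr_fderiv ?_
    ext <;> simp [e', e, mul_comm]
  set P' : ℝ × ℝ → (ℝ × ℝ) →L[ℝ] ℂ := fun x =>
    (x.1 : ℂ) • e' x + e x • (Complex.ofRealCLM ∘L ContinuousLinearMap.fst ℝ ℝ ℝ) with hP'
  have hdP : ∀ x, HasFDerivAt P (P' x) x := by
    intro x
    have h1 : HasFDerivAt (fun x : ℝ × ℝ => (x.1 : ℂ))
      (Complex.ofRealCLM ∘L ContinuousLinearMap.fst ℝ ℝ ℝ) x :=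
      (Complex.ofRealCLM ∘L ContinuousLinearMap.fst ℝ ℝ ℝ).hasFDerivAt
    exact h1.mul (hde x)
  have hdω : ∀ x ∈ Ioo (0 : ℝ) 1 ×ˢ Ioo (-Real.pi) Real.pi,
      HasFDerivAt (fun x => ω (P x)) ((fderivWithin ℝ ω B (P x)) ∘L (P' x)) x := by
    rintro x ⟨⟨h0, h1⟩, -⟩
    have hmem : B ∈ 𝓝 (P x) := Metric.closedBall_mem_nhds_of_mem (by
      simpa [P, hnorm, abs_of_pos h0] using h1)
    have : DifferentiableAt ℝ ω (P x) :=
      ((hω.differentiableOn one_ne_zero) _ (mem_of_mem_nhds hmem)).differentiableAt hmem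
    have h := this.hasFDerivAt
    rw [← fderivWithin_of_mem_nhds hmem] at h
    exact h.comp x (hdP x)
  have hωP : ContinuousOn (fun x => ω (P x)) (Icc 0 1 ×ˢ Icc (-Real.pi) Real.pi) :=
    hω.continuousOn.comp hPc.continuousOn hPB
  have hDP : ContinuousOn (fun x : ℝ × ℝ => x.1 * D (P x)) (Icc 0 1 ×ˢ Icc (-Real.pi) Real.pi) :=
    continuousOn_fst.mul (hDc.comp hPc.continuousOn hPB)
  -- With P = r e, this is ∂_r of the angular component minus ∂_θ of the radial one. The terms in
  -- which ω itself is undifferentiated are both ω(ie) and cancel; the curl is invariant under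
  -- rotation of the frame, and the factor r is the polar Jacobian.
  have hdiv : ∀ x : ℝ × ℝ, ((ω (P x)) ∘L (Complex.I • P' x) +
      ((fderivWithin ℝ ω B (P x)) ∘L (P' x)).flip (Complex.I * P x)) (1, 0) +
      (-((ω (P x)) ∘L (e' x) +
        ((fderivWithin ℝ ω B (P x)) ∘L (P' x)).flip (e x))) (0, 1) = x.1 * D (P x) := by
    intro x
    have hsq : (e x).re ^ 2 + (e x).im ^ 2 = 1 := by
      have := hnorm x
      rw [← sq_eq_sq₀ (norm_nonneg _) zero_le_one, ← Complex.normSq_eq_norm_sq,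
        Complex.normSq_apply] at this
      linarith
    have e1 : e x = (e x).re • (1 : ℂ) + (e x).im • Complex.I := by
      apply Complex.ext <;> simp
    have e2 : Complex.I * e x = (e x).re • Complex.I - (e x).im • (1 : ℂ) := by
      apply Complex.ext <;> simp
    have e3 : Complex.I * P x = x.1 • (Complex.I * e x) := by
      simp only [P, Complex.real_smul]
      ring
    have p1 : P' x (1, 0) = e x := by simp [P', e']
    have p2 : P' x (0, 1) = x.1 • (Complex.I * e x) := by
      simp [P', e', mul_comm]
    have p3 : e' x (0, 1) = Complex.I * e x := by
      simp [e']
      ring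
    simp only [add_apply, neg_apply,
      ContinuousLinearMap.comp_apply, smul_apply,
      ContinuousLinearMap.flip_apply, p1, p2, p3, e3, smul_eq_mul, D]
    generalize fderivWithin ℝ ω B (P x) = W
    have w1 : ∀ (α β : ℝ) (u v : ℂ), u = α • (1 : ℂ) + β • Complex.I →
        v = α • Complex.I - β • (1 : ℂ) → α ^ 2 + β ^ 2 = 1 →
        W u v - W v u = W 1 Complex.I - W Complex.I 1 := by
      rintro α β u v rfl rfl h
      simp only [map_add, map_sub, map_smul, add_apply, sub_apply, smul_apply, smul_eq_mul]
      linear_combination (W 1 Complex.I - W Complex.I 1) * h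
    rw [← w1 _ _ _ _ e1 e2 hsq]
    simp only [map_smul, smul_apply, smul_eq_mul]
    ring
  have hmain := integral_divergence_prod_Icc_of_hasFDerivAt_of_le
    (fun x => ω (P x) (Complex.I * P x)) (fun x => -(ω (P x) (e x)))
    (fun x => (ω (P x)) ∘L (Complex.I • P' x) +
      ((fderivWithin ℝ ω B (P x)) ∘L (P' x)).flip (Complex.I * P x))
    (fun x => -((ω (P x)) ∘L (e' x) +
        ((fderivWithin ℝ ω B (P x)) ∘L (P' x)).flip (e x)))
    (0, -Real.pi) (1, Real.pi) ⟨zero_le_one, by simp only; linarith⟩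
    (by
      rw [← Icc_prod_Icc]
      exact hωP.clm_apply (by fun_prop))
    (by
      rw [← Icc_prod_Icc]
      exact (hωP.clm_apply (by fun_prop)).neg)
    (fun x hx => (hdω x hx).clm_apply ((hdP x).const_mul Complex.I))
    (fun x hx => ((hdω x hx).clm_apply (hde x)).neg)
    (by
      simp_rw [hdiv]
      rw [← Icc_prod_Icc]
      exact hDP.integrableOn_compact (isCompact_Icc.prod isCompact_Icc))
  simp_rw [hdiv] at hmain
  have hpolar : ∫ z in Metric.ball (0 : ℂ) 1,
      (fderiv ℝ ω z 1 Complex.I - fderiv ℝ ω z Complex.I 1) =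
      ∫ x in Icc ((0 : ℝ), -Real.pi) (1, Real.pi), x.1 * D (P x) := by
    have h1 : ∫ z in Metric.ball (0 : ℂ) 1,
        (fderiv ℝ ω z 1 Complex.I - fderiv ℝ ω z Complex.I 1) =
        ∫ z in Metric.ball (0 : ℂ) 1, D z :=
      setIntegral_congr_fun measurableSet_ball fun z hz => by
        simp only [D, fderivWithin_of_mem_nhds (Metric.closedBall_mem_nhds_of_mem hz), hB]
    have hbox : (Icc (0 : ℝ) 1 ×ˢ Icc (-Real.pi) Real.pi : Set (ℝ × ℝ)) =ᵐ[volume]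
        (Ioo (0 : ℝ) 1 ×ˢ Ioo (-Real.pi) Real.pi : Set (ℝ × ℝ)) :=
      Measure.set_prod_ae_eq Ioo_ae_eq_Icc.symm Ioo_ae_eq_Icc.symm
    rw [h1, ← integral_indicator measurableSet_ball, ← Complex.integral_comp_polarCoord_symm,
      ← Icc_prod_Icc, setIntegral_congr_set hbox,
      ← integral_indicator (measurableSet_Ioo.prod measurableSet_Ioo),
      ← integral_indicator polarCoord.open_target.measurableSet]
    refine integral_congr_ae (Eventually.of_forall fun x => ?_)
    by_cases hx : x ∈ polarCoord.target
    · have hx0 : 0 < x.1 := by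
        rw [polarCoord_target] at hx
        exact hx.1
      have hPx : Complex.polarCoord.symm x = P x := by
        rw [Complex.polarCoord_symm_apply]
        simp only [P, e]
        rw [Complex.exp_mul_I]
        simp
      have hx2 : x.2 ∈ Ioo (-Real.pi) Real.pi := by
        rw [polarCoord_target] at hx
        exact hx.2
      by_cases h1x : x.1 < 1
      · have hb : P x ∈ Metric.ball (0 : ℂ) 1 := by
          simpa [P, hnorm, abs_of_pos hx0] using h1x
        have hbx : x ∈ Ioo (0 : ℝ) 1 ×ˢ Ioo (-Real.pi) Real.pi := ⟨⟨hx0, h1x⟩, hx2⟩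
        simp only [indicator_of_mem hx, indicator_of_mem hbx, hPx, indicator_of_mem hb, smul_eq_mul]
      · have hb : P x ∉ Metric.ball (0 : ℂ) 1 := by
          simpa [P, hnorm, abs_of_pos hx0] using h1x
        have hbx : x ∉ Ioo (0 : ℝ) 1 ×ˢ Ioo (-Real.pi) Real.pi := fun h => h1x h.1.2
        simp only [indicator_of_mem hx, indicator_of_notMem hbx, hPx, indicator_of_notMem hb,
          smul_zero]
    · have hbx : x ∉ Ioo (0 : ℝ) 1 ×ˢ Ioo (-Real.pi) Real.pi := fun h => hx (by
        rw [polarCoord_target]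
        exact ⟨h.1.1, h.2⟩)
      simp only [indicator_of_notMem hx, indicator_of_notMem hbx]
  rw [hpolar, hmain]
  -- Polar coordinates use angles in (-π, π), whereas the boundary integral runs over [0, 2π].
  have hper : Function.Periodic (fun t : ℝ =>
      ω (Complex.exp (t * Complex.I)) (Complex.I * Complex.exp (t * Complex.I)))
      (2 * Real.pi) := by
    intro t
    have : Complex.exp (((t + 2 * Real.pi : ℝ) : ℂ) * Complex.I) = Complex.exp (t * Complex.I) := by
      push_cast
      rw [add_mul, Complex.exp_add, Complex.exp_two_pi_mul_I, mul_one]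
    simp only [this]
  have h2 := hper.intervalIntegral_add_eq (-Real.pi) 0
  rw [zero_add, show -Real.pi + 2 * Real.pi = Real.pi by ring] at h2
  rw [← h2]
  -- The edges θ = ±π of the rectangle cancel since e takes the same value there, and the edge r = 0
  -- contributes ω(0)(0) = 0.
  simp [P, e]

/-- **Stokes' theorem** for the pull-back of a one-form to the closed unit disk. -/
theorem integral_ball_pullback {E : Type*} [NormedAddCommGroup E] [NormedSpace ℝ E]
    {α : E → E →L[ℝ] ℝ} {s : Set E} (hs : IsOpen s) (hα : ContDiffOn ℝ 1 α s) {κ : ℂ → E}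
    (hκ : ContDiffOn ℝ 2 κ (Metric.closedBall 0 1)) (hκs : MapsTo κ (Metric.closedBall 0 1) s) :
    ∫ z in Metric.ball (0 : ℂ) 1,
        (fderiv ℝ α (κ z) (fderiv ℝ κ z 1) (fderiv ℝ κ z Complex.I) -
          fderiv ℝ α (κ z) (fderiv ℝ κ z Complex.I) (fderiv ℝ κ z 1)) =
      ∫ t in (0 : ℝ)..(2 * Real.pi),
        α (κ (Complex.exp (t * Complex.I))) (deriv (fun τ : ℝ => κ (Complex.exp (τ * Complex.I))) t) := by
  set B := Metric.closedBall (0 : ℂ) 1 with hB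
  have hBu : UniqueDiffOn ℝ B := uniqueDiffOn_convex (convex_closedBall _ _)
    ⟨0, by rw [interior_closedBall _ one_ne_zero]; simp⟩
  have hω : ContDiffOn ℝ 1 (fun z => (α (κ z)) ∘L (fderivWithin ℝ κ B z)) B :=
    (hα.comp (hκ.of_le one_le_two) hκs).clm_comp
      (hκ.fderivWithin hBu (by norm_num))
  have hgreen := integral_ball_curl _ hω
  have hL : ∀ z ∈ Metric.ball (0 : ℂ) 1,
      fderiv ℝ α (κ z) (fderiv ℝ κ z 1) (fderiv ℝ κ z Complex.I) -
          fderiv ℝ α (κ z) (fderiv ℝ κ z Complex.I) (fderiv ℝ κ z 1) =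
      fderiv ℝ (fun z => (α (κ z)) ∘L (fderivWithin ℝ κ B z)) z 1 Complex.I -
        fderiv ℝ (fun z => (α (κ z)) ∘L (fderivWithin ℝ κ B z)) z Complex.I 1 := by
    intro z hz
    have hzB : B ∈ 𝓝 z := Metric.closedBall_mem_nhds_of_mem hz
    have hκz : ContDiffAt ℝ 2 κ z := hκ.contDiffAt hzB
    have hsymm : IsSymmSndFDerivAt ℝ κ z := hκz.isSymmSndFDerivAt (by simp)
    have hev : (fun z => (α (κ z)) ∘L (fderivWithin ℝ κ B z)) =ᶠ[𝓝 z]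
        fun z => (α (κ z)) ∘L (fderiv ℝ κ z) := by
      filter_upwards [eventually_mem_nhds_iff.2 hzB] with y hy
      rw [fderivWithin_of_mem_nhds hy]
    have hαz : HasFDerivAt α (fderiv ℝ α (κ z)) (κ z) :=
      ((hα.contDiffAt (hs.mem_nhds (hκs (mem_of_mem_nhds hzB)))).differentiableAt
        one_ne_zero).hasFDerivAt
    have h1 : HasFDerivAt κ (fderiv ℝ κ z) z := (hκz.differentiableAt two_ne_zero).hasFDerivAt
    have h2 : HasFDerivAt (fderiv ℝ κ) (fderiv ℝ (fderiv ℝ κ) z) z :=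
      ((hκz.fderiv_right (m := 1) (by norm_num)).differentiableAt one_ne_zero).hasFDerivAt
    have h3 := (hαz.comp z h1).clm_comp h2
    rw [hev.fderiv_eq, HasFDerivAt.fderiv (f := fun z => (α (κ z)) ∘L (fderiv ℝ κ z)) h3]
    -- The second derivatives of κ enter symmetrically and drop out of the antisymmetrised
    -- expression; this is where C² is needed.
    have := hsymm 1 Complex.I
    simp [this]
  rw [setIntegral_congr_fun measurableSet_ball hL, hgreen]
  refine intervalIntegral.integral_congr fun t _ => ?_
  have hmem : ∀ τ : ℝ, Complex.exp (τ * Complex.I) ∈ B := fun τ => by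
    simp [hB, Complex.norm_exp_ofReal_mul_I]
  have he : HasDerivAt (fun τ : ℝ => Complex.exp (τ * Complex.I))
      (Complex.I * Complex.exp (t * Complex.I)) t := by
    have := (((hasDerivAt_id t).ofReal_comp).mul_const Complex.I).cexp
    refine this.congr_deriv ?_
    simp [mul_comm]
  -- On the boundary circle κ has only a derivative within the closed disk, which suffices because
  -- the circle stays in the disk.
  have hd := (((hκ.differentiableOn two_ne_zero) _ (hmem t)).hasFDerivWithinAt).comp_hasDerivAt t he
    (Eventually.of_forall hmem)
  have hd' : HasDerivAt (fun τ : ℝ => κ (Complex.exp (τ * Complex.I))) _ t := hd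
  simp only [hd'.deriv, ContinuousLinearMap.comp_apply]

/-! ### The primitive of the contracted volume form, and the disk term of the flux. -/

theorem isOpen_upperHalf : IsOpen upperHalf := isOpen_lt continuous_const continuous_snd

theorem contDiffOn_primForm (a b c : ℂ) : ContDiffOn ℝ 1 (primForm a b c) upperHalf := by
  refine contDiffOn_clm_apply.2 fun V => ?_
  have hw : ∀ p ∈ upperHalf, ((p.2 : ℝ) : ℂ) ≠ 0 := fun p hp => by
    exact_mod_cast (show p.2 ≠ 0 from ne_of_gt hp)
  have hof : ContDiff ℝ 1 (fun p : ℂ × ℝ => (p.2 : ℂ)) :=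
    Complex.ofRealCLM.contDiff.comp contDiff_snd
  have hconj : ContDiff ℝ 1 (fun p : ℂ × ℝ => conj p.1) :=
    Complex.conjCLE.contDiff.comp contDiff_fst
  simp_rw [primForm_apply]
  refine ContDiffOn.add ?_ ?_
  · refine Complex.imCLM.contDiff.comp_contDiffOn (ContDiffOn.mul (ContDiffOn.sub
      (ContDiffOn.mul ?_ (ContDiffOn.inv ?_ ?_)) contDiffOn_const) contDiffOn_const)
    · exact ((contDiff_const.sub (contDiff_const.mul hconj)).sub
        (contDiff_const.mul (hconj.pow 2))).contDiffOn
    · exact (hof.pow 2).contDiffOn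
    · exact fun p hp => pow_ne_zero 2 (hw p hp)
  · refine ContDiffOn.mul (Complex.imCLM.contDiff.comp_contDiffOn
      (ContDiffOn.mul ?_ (ContDiffOn.inv ?_ ?_))) contDiffOn_const
    · exact (contDiff_const.mul (contDiff_const.add (contDiff_const.mul hconj))).contDiffOn
    · exact hof.contDiffOn
    · exact hw

theorem fderiv_primForm_apply (a b c : ℂ) {p : ℂ × ℝ} (hp : p ∈ upperHalf) (U V : ℂ × ℝ) :
    fderiv ℝ (primForm a b c) p U V =
      (((-2 * conj a - 2 * conj b * conj p.1) * conj U.1 / (p.2 : ℂ) ^ 2 -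
        2 * (conj c - 2 * conj a * conj p.1 - conj b * conj p.1 ^ 2) * U.2 / (p.2 : ℂ) ^ 3) *
          V.1).im +
      (-2 * conj b * conj U.1 / (p.2 : ℂ) +
        2 * (conj a + conj b * conj p.1) * U.2 / (p.2 : ℂ) ^ 2).im * V.2 := by
  have hd : HasFDerivAt (primForm a b c) (fderiv ℝ (primForm a b c) p) p :=
    (((contDiffOn_primForm a b c).contDiffAt (isOpen_upperHalf.mem_nhds hp)).differentiableAt
      one_ne_zero).hasFDerivAt
  -- The Fréchet derivative is read off along the line p + τU, where the explicit formula can be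
  -- differentiated in one real variable.
  have hline : HasDerivAt (fun τ : ℝ => p + τ • U) U 0 := by
    simpa using ((hasDerivAt_id (0 : ℝ)).smul_const U).const_add p
  have hp0 : p = p + (0 : ℝ) • U := by simp
  have h1 : HasDerivAt (fun τ : ℝ => primForm a b c (p + τ • U) V)
      (fderiv ℝ (primForm a b c) p U V) 0 := by
    have := (hp0 ▸ hd : HasFDerivAt (primForm a b c) (fderiv ℝ (primForm a b c) p)
      (p + (0 : ℝ) • U)).comp_hasDerivAt (0 : ℝ) hline
    simpa using this.clm_apply (hasDerivAt_const (0 : ℝ) V)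
  refine h1.unique ?_
  simp_rw [primForm_apply]
  have hw : (p.2 : ℂ) ≠ 0 := by exact_mod_cast (show p.2 ≠ 0 from ne_of_gt hp)
  have hζ : HasDerivAt (fun τ : ℝ => conj (p + τ • U).1) (conj U.1) 0 :=
    (Complex.conjCLE.toContinuousLinearMap ∘L ContinuousLinearMap.fst ℝ ℂ ℝ).hasFDerivAt.comp_hasDerivAt
      (0 : ℝ) hline
  have hw' : HasDerivAt (fun τ : ℝ => ((p + τ • U).2 : ℂ)) (U.2 : ℂ) 0 :=
    (Complex.ofRealCLM ∘L ContinuousLinearMap.snd ℝ ℂ ℝ).hasFDerivAt.comp_hasDerivAt (0 : ℝ) hline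
  have e1 := ((((hζ.const_mul (2 * conj a)).const_sub (conj c)).sub
    ((hζ.pow 2).const_mul (conj b))).div (hw'.pow 2) (by simpa using hw)).sub_const b |>.mul_const V.1
  have e2 := (((hζ.const_mul (conj b)).const_add (conj a)).const_mul (-2)).div hw'
    (by simpa using hw)
  refine ((Complex.imCLM.hasFDerivAt.comp_hasDerivAt (0 : ℝ) e1).add
    ((Complex.imCLM.hasFDerivAt.comp_hasDerivAt (0 : ℝ) e2).mul_const V.2)).congr_deriv ?_
  simp only [zero_smul, add_zero, Complex.imCLM_apply]
  congr 2
  · congr 1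
    simp
    field_simp
  · congr 1
    field_simp
    ring

/-- The exterior derivative of `primForm a b c` is twice the interior product of the volume form
with `killing a b c`. -/
theorem fderiv_primForm_sub (a b c : ℂ) {p : ℂ × ℝ} (hp : p ∈ upperHalf) (U V : ℂ × ℝ) :
    fderiv ℝ (primForm a b c) p U V - fderiv ℝ (primForm a b c) p V U =
      2 * (orientDet U V (killing a b c p) / p.2 ^ 3) := by
  rw [fderiv_primForm_apply a b c hp, fderiv_primForm_apply a b c hp]
  have hw : p.2 ≠ 0 := ne_of_gt hp
  obtain ⟨⟨x, y⟩, w⟩ := p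
  simp only at hw
  have h3 : (w : ℂ) ^ 3 = ((w ^ 3 : ℝ) : ℂ) := by push_cast; rfl
  have h2 : (w : ℂ) ^ 2 = ((w ^ 2 : ℝ) : ℂ) := by push_cast; rfl
  simp [orientDet, Matrix.det_fin_three, killing, h3, h2, Complex.div_ofReal_im,
    Complex.div_ofReal_re, -Complex.ofReal_pow]
  simp [pow_two]
  field_simp
  ring

/-- The flux of a Killing field through a disk in `ℍ³`. -/
theorem two_mul_integral_disk_eq (a b c : ℂ) {κ : ℂ → ℂ × ℝ} {Y : ℂ × ℝ → ℂ × ℝ}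
    (hY : ∀ p ∈ upperHalf, Y p = killing a b c p)
    (hκ : ContDiffOn ℝ 2 κ (Metric.closedBall 0 1))
    (hκs : MapsTo κ (Metric.closedBall 0 1) upperHalf) :
    2 * ∫ z in Metric.ball (0 : ℂ) 1,
      hypInner (κ z) (unitNormal (κ z) (fderiv ℝ κ z 1) (fderiv ℝ κ z Complex.I)) (Y (κ z))
        * hypArea (κ z) (fderiv ℝ κ z 1) (fderiv ℝ κ z Complex.I) =
    ∫ t in (0 : ℝ)..(2 * Real.pi), primForm a b c (κ (Complex.exp (t * Complex.I)))
      (deriv (fun τ : ℝ => κ (Complex.exp (τ * Complex.I))) t) := by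
  rw [← integral_ball_pullback isOpen_upperHalf (contDiffOn_primForm a b c) hκ hκs,
    ← integral_const_mul]
  refine setIntegral_congr_fun measurableSet_ball fun z hz => ?_
  have hp : κ z ∈ upperHalf := hκs (Metric.ball_subset_closedBall hz)
  rw [fderiv_primForm_sub a b c hp, hY _ hp, hypInner_unitNormal_mul_hypArea hp]

/-! ### Contour integrals about the puncture, in the logarithmic coordinate. -/

/-- Large disks tangent to the line Re s = L from the left exhaust the half-plane. Disks are wanted
because holomorphic functions on them have primitives. -/
theorem exists_ball_of_isCompact_of_re_lt {K : Set ℂ} (hK : IsCompact K) {L : ℝ}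
    (hKL : ∀ s ∈ K, s.re < L) :
    ∃ (c : ℂ) (r : ℝ), K ⊆ Metric.ball c r ∧ Metric.ball c r ⊆ {s | s.re < L} := by
  rcases K.eq_empty_or_nonempty with rfl | hne
  · exact ⟨0, 0, by simp, by simp⟩
  obtain ⟨s₀, hs₀, hmax⟩ := hK.exists_isMaxOn hne Complex.continuous_re.continuousOn
  obtain ⟨C, hC⟩ := hK.isBounded.exists_norm_le
  set δ := L - s₀.re with hδ
  have hδ0 : 0 < δ := sub_pos.2 (hKL s₀ hs₀)
  -- The disk has centre -M and radius M + L. A point s lies in it exactly when (Im s)² < (L - Re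
  -- s)(L + Re s + 2M); the first factor is at least δ on K, so the second need only exceed C²/δ.
  set M : ℝ := C ^ 2 / δ + C + |L| + 1 with hM
  have hC0 : 0 ≤ C := (norm_nonneg _).trans (hC s₀ hs₀)
  have hML : 0 < M + L := by
    have := neg_abs_le L
    have : 0 ≤ C ^ 2 / δ := by positivity
    rw [hM]; linarith
  refine ⟨-M, M + L, fun s hs => ?_, fun s hs => ?_⟩
  · rw [mem_ball_iff_norm, ← sq_lt_sq₀ (norm_nonneg _) hML.le, ← Complex.normSq_eq_norm_sq,
      Complex.normSq_apply]
    have h1 : s.re ≤ s₀.re := hmax hs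
    have h2 : |s.re| ≤ C := (Complex.abs_re_le_norm s).trans (hC s hs)
    have h3 : |s.im| ≤ C := (Complex.abs_im_le_norm s).trans (hC s hs)
    have h4 : s.im ^ 2 ≤ C ^ 2 := sq_le_sq' (abs_le.1 h3).1 (abs_le.1 h3).2
    have h5 : C ^ 2 < δ * (s.re + L + 2 * M) := by
      have h6 : C ^ 2 = δ * (C ^ 2 / δ) := by field_simp
      rw [h6]
      refine mul_lt_mul_of_pos_left ?_ hδ0
      have := (abs_le.1 h2).1
      have := neg_abs_le L
      have := abs_nonneg L
      have : 0 ≤ C ^ 2 / δ := by positivity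
      rw [hM]; linarith
    have h7 : δ * (s.re + L + 2 * M) ≤ (L - s.re) * (s.re + L + 2 * M) := by
      refine mul_le_mul_of_nonneg_right (by rw [hδ]; linarith) ?_
      by_contra! hneg
      nlinarith [sq_nonneg C]
    simp
    nlinarith
  · rw [mem_ball_iff_norm] at hs
    have := (Complex.abs_re_le_norm _).trans_lt hs
    have := (abs_lt.1 this).2
    simp only [Complex.sub_re, Complex.neg_re, Complex.ofReal_re] at this
    change s.re < L
    linarith

/-- Over paths joining a point to its translate by `± 2πi`, the integral of a `2πi`-periodic
holomorphic function on a half-plane depends only on the sign. -/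
theorem integral_comp_mul_deriv_of_periodic {φ : ℂ → ℂ} {L : ℝ}
    (hφ : DifferentiableOn ℂ φ {s | s.re < L})
    (hper : ∀ s : ℂ, s.re < L → φ (s + 2 * Real.pi * Complex.I) = φ s)
    {σ τ : ℝ → ℂ} (hσ : ContDiff ℝ 1 σ) (hτ : ContDiff ℝ 1 τ)
    (hσL : ∀ t, (σ t).re < L) (hτL : ∀ t, (τ t).re < L) {ε : ℤ} (hε : ε = 1 ∨ ε = -1)
    (hσε : σ (2 * Real.pi) = σ 0 + ε * (2 * Real.pi * Complex.I))
    (hτ1 : τ (2 * Real.pi) = τ 0 + 2 * Real.pi * Complex.I) :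
    ∫ t in (0 : ℝ)..(2 * Real.pi), φ (σ t) * deriv σ t =
      ε * ∫ t in (0 : ℝ)..(2 * Real.pi), φ (τ t) * deriv τ t := by
  have hK : IsCompact (σ '' Icc 0 (2 * Real.pi) ∪ τ '' Icc 0 (2 * Real.pi)) :=
    (isCompact_Icc.image hσ.continuous).union (isCompact_Icc.image hτ.continuous)
  obtain ⟨c, r, hKB, hBL⟩ := exists_ball_of_isCompact_of_re_lt hK (L := L) (by
    rintro s (⟨t, -, rfl⟩ | ⟨t, -, rfl⟩)
    exacts [hσL t, hτL t])
  obtain ⟨H, hH⟩ := (hφ.mono hBL).isExactOn_ball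
  have h2pi : (0 : ℝ) ≤ 2 * Real.pi := by positivity
  have hpath : ∀ ρ : ℝ → ℂ, ContDiff ℝ 1 ρ → ρ '' Icc 0 (2 * Real.pi) ⊆ Metric.ball c r →
      ∫ t in (0 : ℝ)..(2 * Real.pi), φ (ρ t) * deriv ρ t = H (ρ (2 * Real.pi)) - H (ρ 0) := by
    intro ρ hρ hρB
    refine intervalIntegral.integral_eq_sub_of_hasDerivAt (f := fun t => H (ρ t)) ?_ ?_
    · intro t ht
      rw [uIcc_of_le h2pi] at ht
      exact (hH _ (hρB ⟨t, ht, rfl⟩)).comp_of_eq t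
        ((hρ.differentiable one_ne_zero).differentiableAt.hasDerivAt) rfl
    · refine ContinuousOn.intervalIntegrable ?_
      rw [uIcc_of_le h2pi]
      refine ContinuousOn.mul ?_ (hρ.continuous_deriv le_rfl).continuousOn
      exact (hφ.continuousOn.mono hBL).comp hρ.continuous.continuousOn
        fun t ht => hρB ⟨t, ht, rfl⟩
  rw [hpath σ hσ (subset_union_left.trans hKB), hpath τ hτ (subset_union_right.trans hKB)]
  set p : ℂ := 2 * Real.pi * Complex.I with hp
  -- On this convex set H(s + p) - H(s) has derivative zero by periodicity. Its constant value is
  -- the integral over any path in the disk from s to s + p.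
  set S : Set ℂ := Metric.ball c r ∩ (fun s => s + p) ⁻¹' Metric.ball c r with hS
  have hSo : IsOpen S := Metric.isOpen_ball.inter
    (Metric.isOpen_ball.preimage (continuous_id.add continuous_const))
  have hSc : IsPreconnected S := by
    refine ((convex_ball c r).inter ?_).isPreconnected
    exact (convex_ball c r).translate_preimage_left p
  have hd : ∀ s ∈ S, HasDerivAt (fun s => H (s + p) - H s) 0 s := by
    intro s hs
    have h1 := ((hH _ hs.2).comp_add_const s p).sub (hH s hs.1)
    rw [hper s (hBL hs.1), sub_self] at h1
    exact h1
  have hconst : ∀ s ∈ S, ∀ s' ∈ S, H (s + p) - H s = H (s' + p) - H s' := by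
    intro s hs s' hs'
    exact hSo.is_const_of_deriv_eq_zero hSc
      (fun s hs => (hd s hs).differentiableAt.differentiableWithinAt)
      (fun s hs => (hd s hs).deriv) hs hs'
  have hτB : τ 0 ∈ S := by
    refine ⟨hKB (Or.inr ⟨0, ⟨le_rfl, h2pi⟩, rfl⟩), ?_⟩
    have : τ (2 * Real.pi) ∈ Metric.ball c r := hKB (Or.inr ⟨_, ⟨h2pi, le_rfl⟩, rfl⟩)
    rwa [hτ1] at this
  have hσ0 : σ 0 ∈ Metric.ball c r := hKB (Or.inl ⟨0, ⟨le_rfl, h2pi⟩, rfl⟩)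
  have hσ1 : σ (2 * Real.pi) ∈ Metric.ball c r := hKB (Or.inl ⟨_, ⟨h2pi, le_rfl⟩, rfl⟩)
  rw [hτ1]
  rcases hε with rfl | rfl
  · simp only [Int.cast_one, one_mul] at hσε ⊢
    rw [hσε] at hσ1 ⊢
    exact hconst _ ⟨hσ0, hσ1⟩ _ hτB
  · simp only [Int.cast_neg, Int.cast_one, neg_mul, one_mul] at hσε ⊢
    -- For ε = -1 the path descends by p, so the constant is evaluated at its final point and occurs
    -- with the opposite sign.
    have hσ0' : σ 0 = σ (2 * Real.pi) + p := by rw [hσε]; ring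
    rw [← hconst (σ (2 * Real.pi)) ⟨hσ1, by
      change σ (2 * Real.pi) + p ∈ Metric.ball c r
      rwa [← hσ0']⟩ _ hτB, ← hσ0']
    ring

/-- The integral of a holomorphic function on a punctured disk along a closed curve running once
around the puncture, given by its logarithm. -/
theorem integral_exp_path_eq_residueAtZero {h : ℂ → ℂ} {R : ℝ}
    (hh : ∀ z, z ≠ 0 → ‖z‖ < R → DifferentiableAt ℂ h z)
    {σ : ℝ → ℂ} (hσ : ContDiff ℝ 1 σ) (hσR : ∀ t, ‖Complex.exp (σ t)‖ < R)
    {ε : ℤ} (hε : ε = 1 ∨ ε = -1)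
    (hσε : σ (2 * Real.pi) = σ 0 + ε * (2 * Real.pi * Complex.I)) :
    ∫ t in (0 : ℝ)..(2 * Real.pi), h (Complex.exp (σ t)) * (Complex.exp (σ t) * deriv σ t) =
      ε * (2 * Real.pi * Complex.I * residueAtZero h) := by
  have hR : 0 < R := (norm_nonneg _).trans_lt (hσR 0)
  have hiff : ∀ s : ℂ, s.re < Real.log R ↔ ‖Complex.exp s‖ < R := fun s => by
    rw [Complex.norm_exp, Real.lt_log_iff_exp_lt hR]
  set φ : ℂ → ℂ := fun s => h (Complex.exp s) * Complex.exp s with hφdef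
  have hφ : DifferentiableOn ℂ φ {s | s.re < Real.log R} := fun s hs =>
    (((hh _ (Complex.exp_ne_zero s) ((hiff s).1 hs)).comp s
      Complex.differentiable_exp.differentiableAt).mul
        Complex.differentiable_exp.differentiableAt).differentiableWithinAt
  have hper : ∀ s : ℂ, s.re < Real.log R → φ (s + 2 * Real.pi * Complex.I) = φ s := fun s _ => by
    simp only [φ, Complex.exp_add, Complex.exp_two_pi_mul_I, mul_one]
  have hline : ∀ r : ℝ, ContDiff ℝ 1 (fun t : ℝ => (Real.log r : ℂ) + t * Complex.I) := fun r =>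
    contDiff_const.add (Complex.ofRealCLM.contDiff.mul contDiff_const)
  have hcirc : ∀ r : ℝ, 0 < r → r < R → ∫ t in (0 : ℝ)..(2 * Real.pi), φ (σ t) * deriv σ t =
      ε * ∮ z in C(0, r), h z := by
    intro r hr0 hrR
    have h1 := integral_comp_mul_deriv_of_periodic hφ hper hσ (hline r) (fun t => (hiff _).2 (hσR t))
      (fun t => by simpa using Real.log_lt_log hr0 hrR) hε hσε (by simp)
    rw [h1, circleIntegral]
    congr 1
    refine intervalIntegral.integral_congr fun t _ => ?_
    have hd : deriv (fun t : ℝ => (Real.log r : ℂ) + t * Complex.I) t = Complex.I := by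
      have := (((hasDerivAt_id t).ofReal_comp).mul_const Complex.I).const_add (Real.log r : ℂ)
      simpa using this.deriv
    have he : Complex.exp ((Real.log r : ℂ) + t * Complex.I) = circleMap 0 r t := by
      rw [Complex.exp_add, ← Complex.ofReal_exp, Real.exp_log hr0, circleMap, zero_add]
    simp only [φ, hd, he, deriv_circleMap, smul_eq_mul]
    ring
  have hεε : (ε : ℂ) * ε = 1 := by rcases hε with rfl | rfl <;> simp
  have hpi : (2 * Real.pi * Complex.I : ℂ) ≠ 0 := Complex.two_pi_I_ne_zero
  set J := ∫ t in (0 : ℝ)..(2 * Real.pi), φ (σ t) * deriv σ t with hJ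
  have hres : residueAtZero h = (2 * Real.pi * Complex.I)⁻¹ * (ε * J) := by
    -- The circle integrals do not depend on the small radius, so the limit defining the residue is
    -- that of an eventually constant function.
    refine Tendsto.limUnder_eq (tendsto_const_nhds.congr' ?_)
    filter_upwards [Ioo_mem_nhdsGT hR] with r hr
    rw [hcirc r hr.1 hr.2, ← mul_assoc (ε : ℂ), hεε, one_mul]
  rw [hres, ← mul_assoc (2 * Real.pi * Complex.I : ℂ), mul_inv_cancel₀ hpi, one_mul, ← mul_assoc,
    hεε, one_mul, hJ]
  simp only [φ, mul_assoc]

/-! ### The curves FF* and the Killing fields that move them. -/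

/-- The matrices whose field vanishes at p form a conjugate of su(2), which contains no complex
line. Testing all complex multiples therefore separates matrices at a single point. -/
theorem killing_coeff_unique {a b c a' b' c' : ℂ} {p : ℂ × ℝ} (hp : p ∈ upperHalf)
    (h : ∀ k : ℂ, killing (a * k) (b * k) (c * k) p = killing (a' * k) (b' * k) (c' * k) p) :
    a = a' ∧ b = b' ∧ c = c' := by
  obtain ⟨ζ, w⟩ := p
  have hw : w ≠ 0 := ne_of_gt hp
  have hwC : (w : ℂ) ^ 2 ≠ 0 := pow_ne_zero 2 (by exact_mod_cast hw)
  have h1 := h 1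
  have h2 := h Complex.I
  simp only [killing, mul_one, Prod.mk.injEq, mul_eq_mul_right_iff, hw, or_false] at h1 h2
  obtain ⟨h1a, h1b⟩ := h1
  obtain ⟨h2a, h2b⟩ := h2
  have hre : (a + b * ζ).re = (a' + b' * ζ).re := by linarith
  have him : (a + b * ζ).im = (a' + b' * ζ).im := by
    have e1 : (a * Complex.I + b * Complex.I * ζ).re = -(a + b * ζ).im := by simp; ring
    have e2 : (a' * Complex.I + b' * Complex.I * ζ).re = -(a' + b' * ζ).im := by simp; ring
    rw [e1, e2] at h2b
    linarith
  have hab : a + b * ζ = a' + b' * ζ := Complex.ext hre him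
  -- Adding i times the equation for k = i to the one for k = 1 kills the complex linear terms and
  -- doubles the antilinear one, `conj b * w ^ 2`.
  have hb' : conj b = conj b' := by
    refine mul_right_cancel₀ hwC ?_
    simp only [map_mul, Complex.conj_I] at h2a
    linear_combination h1a / 2 + Complex.I / 2 * h2a -
      (c - c' - 2 * (a - a') * ζ - (b - b') * ζ ^ 2 - (conj b - conj b') * w ^ 2) / 2 * Complex.I_sq
  have hb : b = b' := (starRingEnd ℂ).injective hb'
  subst hb
  have ha : a = a' := by linear_combination hab
  subst ha
  exact ⟨rfl, rfl, by linear_combination h1a⟩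

theorem halfSpaceOfHermitian_mul_conjTranspose (M : Matrix (Fin 2) (Fin 2) ℂ) :
    halfSpaceOfHermitian (M * M.conjTranspose) =
      ((M 1 0 * conj (M 0 0) + M 1 1 * conj (M 0 1)) /
        (M 0 0 * conj (M 0 0) + M 0 1 * conj (M 0 1)),
        1 / (M 0 0 * conj (M 0 0) + M 0 1 * conj (M 0 1)).re) := by
  simp [halfSpaceOfHermitian, Matrix.mul_apply, Fin.sum_univ_two]

theorem re_row_pos {M : Matrix (Fin 2) (Fin 2) ℂ} (hM : M.det = 1) :
    0 < (M 0 0 * conj (M 0 0) + M 0 1 * conj (M 0 1)).re := by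
  rw [Complex.mul_conj, Complex.mul_conj, Complex.add_re, Complex.ofReal_re, Complex.ofReal_re]
  have h : M 0 0 ≠ 0 ∨ M 0 1 ≠ 0 := by
    by_contra! h
    rw [Matrix.det_fin_two, h.1, h.2] at hM
    simp at hM
  rcases h with h | h
  · exact add_pos_of_pos_of_nonneg (Complex.normSq_pos.2 h) (Complex.normSq_nonneg _)
  · exact add_pos_of_nonneg_of_pos (Complex.normSq_nonneg _) (Complex.normSq_pos.2 h)

theorem halfSpaceOfHermitian_mem {M : Matrix (Fin 2) (Fin 2) ℂ} (hM : M.det = 1) :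
    halfSpaceOfHermitian (M * M.conjTranspose) ∈ upperHalf := by
  rw [halfSpaceOfHermitian_mul_conjTranspose]
  exact one_div_pos.2 (re_row_pos hM)

/-- If `M' = y M` with `y` traceless, then the curve `M M*` in `ℍ³` has the velocity given by the
Killing field of `y`. -/
theorem hasDerivAt_halfSpaceOfHermitian {M : ℝ → Matrix (Fin 2) (Fin 2) ℂ} {a b c : ℂ} {t : ℝ}
    (hdet : (M t).det = 1)
    (hM : ∀ i j, HasDerivAt (fun τ => M τ i j) ((!![a, b; c, -a] * M t) i j) t) :
    HasDerivAt (fun τ => halfSpaceOfHermitian (M τ * (M τ).conjTranspose))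
      (killing a b c (halfSpaceOfHermitian (M t * (M t).conjTranspose))) t := by
  have hpos := re_row_pos hdet
  have hA := hM 0 0
  have hB := hM 0 1
  have hC := hM 1 0
  have hD := hM 1 1
  simp only [Matrix.mul_apply, Fin.sum_univ_two, Matrix.of_apply, Matrix.cons_val', Matrix.cons_val_zero,
    Matrix.cons_val_one, Matrix.cons_val_fin_one] at hA hB hC hD
  have hconj : ∀ {f : ℝ → ℂ} {f' : ℂ}, HasDerivAt f f' t →
      HasDerivAt (fun τ => conj (f τ)) (conj f') t := fun h =>
    Complex.conjCLE.toContinuousLinearMap.hasFDerivAt.comp_hasDerivAt t h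
  have hQ := (hA.mul (hconj hA)).add (hB.mul (hconj hB))
  have hT := (hC.mul (hconj hA)).add (hD.mul (hconj hB))
  have hQr : HasDerivAt (fun τ => (M τ 0 0 * conj (M τ 0 0) + M τ 0 1 * conj (M τ 0 1)).re) _ t :=
    Complex.reCLM.hasFDerivAt.comp_hasDerivAt t hQ
  simp_rw [halfSpaceOfHermitian_mul_conjTranspose]
  rw [Matrix.det_fin_two] at hdet
  have hdetc := congrArg conj hdet
  simp only [map_mul, map_sub, map_one] at hdetc
  have hQ0 : M t 0 0 * conj (M t 0 0) + M t 0 1 * conj (M t 0 1) ≠ 0 := fun h => by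
    rw [h] at hpos; simp at hpos
  refine ((hT.div hQ hQ0).prodMk ((hasDerivAt_const t (1 : ℝ)).div hQr hpos.ne')).congr_deriv ?_
  have hQreal : ((M t 0 0 * conj (M t 0 0) + M t 0 1 * conj (M t 0 1)).re : ℂ) =
      M t 0 0 * conj (M t 0 0) + M t 0 1 * conj (M t 0 1) := by
    rw [← Complex.conj_eq_iff_re]
    simp
    ring
  simp only [Pi.mul_apply, Pi.add_apply]
  generalize M t 0 0 = A at *
  generalize M t 0 1 = B at *
  generalize M t 1 0 = C at *
  generalize M t 1 1 = D at *
  refine Prod.ext ?_ ?_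
  · simp only [killing]
    push_cast
    rw [hQreal]
    simp only [map_mul, map_add]
    field_simp
    linear_combination conj b * (conj A * conj D - conj B * conj C) * hdet + conj b * hdetc
  · simp only [killing]
    have : (a + b * ((C * conj A + D * conj B) / (A * conj A + B * conj B))).re =
      (a * (A * conj A + B * conj B) + b * (C * conj A + D * conj B)).re /
        (A * conj A + B * conj B).re := by
      rw [← Complex.div_ofReal_re, hQreal]
      refine congrArg Complex.re ?_
      rw [eq_div_iff hQ0, add_mul, mul_assoc b, div_mul_cancel₀ _ hQ0]
    rw [this]
    have e : (((a * A + b * C) * conj A + A * conj (a * A + b * C) +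
        ((a * B + b * D) * conj B + B * conj (a * B + b * D)))).re =
        2 * (a * (A * conj A + B * conj B) + b * (C * conj A + D * conj B)).re := by
      simp
      ring
    simp only [Complex.reCLM_apply, e]
    field_simp
    ring

/-! ### The single-valued logarithmic derivative dF F⁻¹ of a Bryant end. -/

/-- The coefficient of `dz` in `D dC - C dD`, the lower left entry of `dF F⁻¹`. -/
def form₀ (F : ℂ → Matrix (Fin 2) (Fin 2) ℂ) (z : ℂ) : ℂ :=
  (F (Complex.log z) 1 1 * deriv (fun s => F s 1 0) (Complex.log z) -
    F (Complex.log z) 1 0 * deriv (fun s => F s 1 1) (Complex.log z)) / z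

/-- The coefficient of `dz` in `C dB - D dA`, the opposite of the upper left entry of `dF F⁻¹`. -/
def form₁ (F : ℂ → Matrix (Fin 2) (Fin 2) ℂ) (z : ℂ) : ℂ :=
  (F (Complex.log z) 1 0 * deriv (fun s => F s 0 1) (Complex.log z) -
    F (Complex.log z) 1 1 * deriv (fun s => F s 0 0) (Complex.log z)) / z

/-- The coefficient of `dz` in `B dA - A dB`, the opposite of the upper right entry of
`dF F⁻¹`. -/
def form₂ (F : ℂ → Matrix (Fin 2) (Fin 2) ℂ) (z : ℂ) : ℂ :=
  (F (Complex.log z) 0 1 * deriv (fun s => F s 0 0) (Complex.log z) -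
    F (Complex.log z) 0 0 * deriv (fun s => F s 0 1) (Complex.log z)) / z

namespace IsBryantEnd

variable {Ω : Set ℂ} {X : ℂ → ℂ × ℝ} {F : ℂ → Matrix (Fin 2) (Fin 2) ℂ}

theorem isOpen_log (hE : IsBryantEnd Ω X F) : IsOpen (Complex.exp ⁻¹' Ω) :=
  hE.isOpen.preimage Complex.continuous_exp

theorem hasDerivAt (hE : IsBryantEnd Ω X F) {s : ℂ} (hs : Complex.exp s ∈ Ω) (i j : Fin 2) :
    HasDerivAt (fun t => F t i j) (deriv (fun t => F t i j) s) s :=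
  ((hE.holomorphic i j).differentiableAt (hE.isOpen_log.mem_nhds hs)).hasDerivAt

theorem deriv_det (hE : IsBryantEnd Ω X F) {s : ℂ} (hs : Complex.exp s ∈ Ω) :
    deriv (fun t => F t 0 0) s * F s 1 1 + F s 0 0 * deriv (fun t => F t 1 1) s -
      (deriv (fun t => F t 0 1) s * F s 1 0 + F s 0 1 * deriv (fun t => F t 1 0) s) = 0 := by
  have h := ((hE.hasDerivAt hs 0 0).mul (hE.hasDerivAt hs 1 1)).sub
    ((hE.hasDerivAt hs 0 1).mul (hE.hasDerivAt hs 1 0))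
  have h1 : HasDerivAt (fun _ : ℂ => (1 : ℂ)) _ s := h.congr_of_eventuallyEq (by
    filter_upwards [hE.isOpen_log.mem_nhds hs] with t ht
    have := hE.det_eq_one t ht
    rw [Matrix.det_fin_two] at this
    exact this.symm)
  exact h1.unique (hasDerivAt_const s 1)

/-- The logarithmic derivative of `F`. -/
theorem deriv_eq_mul (hE : IsBryantEnd Ω X F) {s : ℂ} (hs : Complex.exp s ∈ Ω) (k : ℂ)
    (i j : Fin 2) :
    deriv (fun t => F t i j) s * k =
      (!![(F s 1 1 * deriv (fun t => F t 0 0) s - F s 1 0 * deriv (fun t => F t 0 1) s) * k,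
          (F s 0 0 * deriv (fun t => F t 0 1) s - F s 0 1 * deriv (fun t => F t 0 0) s) * k;
          (F s 1 1 * deriv (fun t => F t 1 0) s - F s 1 0 * deriv (fun t => F t 1 1) s) * k,
          -((F s 1 1 * deriv (fun t => F t 0 0) s - F s 1 0 * deriv (fun t => F t 0 1) s) * k)] *
        F s) i j := by
  have h1 := hE.deriv_det hs
  have h2 := hE.det_eq_one s hs
  rw [Matrix.det_fin_two] at h2
  fin_cases i <;> fin_cases j <;> simp [Matrix.mul_apply, Fin.sum_univ_two]
  · linear_combination (-k * deriv (fun t => F t 0 0) s) * h2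
  · linear_combination (-k * deriv (fun t => F t 0 1) s) * h2
  · linear_combination (-k * deriv (fun t => F t 1 0) s) * h2 + k * F s 1 0 * h1
  · linear_combination (-k * deriv (fun t => F t 1 1) s) * h2 + k * F s 1 1 * h1

theorem mem_upperHalf (hE : IsBryantEnd Ω X F) {z : ℂ} (hz : z ∈ Ω) (hz0 : z ≠ 0) :
    X z ∈ upperHalf := by
  rw [← Complex.exp_log hz0] at hz ⊢
  rw [hE.represents _ hz]
  exact halfSpaceOfHermitian_mem (hE.det_eq_one _ hz)

/-- The branch s + log(y / exp s) of the logarithm takes the value s at exp s and is holomorphic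
nearby, for every s. It replaces the principal branch, which has a cut. -/
theorem hasDerivAt_local_log (s y : ℂ) (hy : y / Complex.exp s ∈ Complex.slitPlane) :
    HasDerivAt (fun y => s + Complex.log (y / Complex.exp s)) y⁻¹ y := by
  have h := (((hasDerivAt_id y).div_const (Complex.exp s)).clog hy).const_add s
  refine h.congr_deriv ?_
  have := Complex.exp_ne_zero s
  have hy0 : y ≠ 0 := by
    rintro rfl
    simp at hy
  simp only [id]
  field_simp

theorem exp_local_log (s : ℂ) {y : ℂ} (hy : y ≠ 0) :
    Complex.exp (s + Complex.log (y / Complex.exp s)) = y := by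
  have := Complex.exp_ne_zero s
  rw [Complex.exp_add, Complex.exp_log (div_ne_zero hy this)]
  field_simp

theorem eventuallyEq_local_log (hE : IsBryantEnd Ω X F) {s : ℂ} (hs : Complex.exp s ∈ Ω) :
    X =ᶠ[𝓝 (Complex.exp s)] fun y => halfSpaceOfHermitian
      (F (s + Complex.log (y / Complex.exp s)) *
        (F (s + Complex.log (y / Complex.exp s))).conjTranspose) := by
  filter_upwards [hE.isOpen.mem_nhds hs, isOpen_ne.mem_nhds (Complex.exp_ne_zero s)] with y hy hy0
  have := hE.represents (s + Complex.log (y / Complex.exp s)) (by rwa [exp_local_log s hy0])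
  rwa [exp_local_log s hy0] at this

theorem contDiffAt (hE : IsBryantEnd Ω X F) {z : ℂ} (hz : z ∈ Ω) (hz0 : z ≠ 0) :
    ContDiffAt ℝ 2 X z := by
  set s := Complex.log z with hs_def
  have hzs : Complex.exp s = z := Complex.exp_log hz0
  have hs : Complex.exp s ∈ Ω := by rwa [hzs]
  rw [← hzs]
  refine ContDiffAt.congr_of_eventuallyEq ?_ (hE.eventuallyEq_local_log hs)
  have hlog : ContDiffAt ℝ 2 (fun y => s + Complex.log (y / Complex.exp s)) (Complex.exp s) := by
    refine ContDiffAt.restrict_scalars ℝ (𝕜' := ℂ) (contDiffAt_const.add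
      ((Complex.contDiffAt_log ?_).comp (Complex.exp s) (contDiffAt_id.div_const _)))
    simp [Complex.exp_ne_zero]
  have hF : ∀ i j, ContDiffAt ℝ 2 (fun y => F (s + Complex.log (y / Complex.exp s)) i j)
      (Complex.exp s) := by
    intro i j
    have h1 : ContDiffAt ℝ 2 (fun t => F t i j) s :=
      ((hE.holomorphic i j).analyticAt (hE.isOpen_log.mem_nhds hs)).contDiffAt.restrict_scalars ℝ
    refine ContDiffAt.comp (Complex.exp s) (g := fun t => F t i j) ?_ hlog
    simpa [Complex.exp_ne_zero] using h1
  have hFc : ∀ i j, ContDiffAt ℝ 2 (fun y => conj (F (s + Complex.log (y / Complex.exp s)) i j))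
      (Complex.exp s) := fun i j =>
    Complex.conjCLE.contDiff.contDiffAt.comp (Complex.exp s) (hF i j)
  simp_rw [halfSpaceOfHermitian_mul_conjTranspose]
  have hQ := ((hF 0 0).mul (hFc 0 0)).add ((hF 0 1).mul (hFc 0 1))
  have hpos : 0 < (F s 0 0 * conj (F s 0 0) + F s 0 1 * conj (F s 0 1)).re :=
    re_row_pos (hE.det_eq_one s hs)
  have hne : F s 0 0 * conj (F s 0 0) + F s 0 1 * conj (F s 0 1) ≠ 0 := fun h => by
    rw [h] at hpos
    simp at hpos
  refine ContDiffAt.prodMk (ContDiffAt.mul (((hF 1 0).mul (hFc 0 0)).add ((hF 1 1).mul (hFc 0 1)))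
    (hQ.inv ?_)) (contDiffAt_const.div (Complex.reCLM.contDiff.contDiffAt.comp (Complex.exp s) hQ) ?_)
  · simpa [Complex.exp_ne_zero] using hne
  · intro h
    have hl0 : s + Complex.log (Complex.exp s / Complex.exp s) = s := by
      simp [Complex.exp_ne_zero]
    refine hpos.ne' ?_
    nth_rewrite 1 2 3 4 [← hl0]
    exact h

/-- Any logarithm s of the point is allowed, not just the principal one: comparing two of them is
what shows that dF F⁻¹ is single-valued. -/
theorem fderiv_exp (hE : IsBryantEnd Ω X F) {s : ℂ} (hs : Complex.exp s ∈ Ω) (h : ℂ) :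
    fderiv ℝ X (Complex.exp s) h =
      killing
        ((F s 1 1 * deriv (fun t => F t 0 0) s - F s 1 0 * deriv (fun t => F t 0 1) s) *
          ((Complex.exp s)⁻¹ * h))
        ((F s 0 0 * deriv (fun t => F t 0 1) s - F s 0 1 * deriv (fun t => F t 0 0) s) *
          ((Complex.exp s)⁻¹ * h))
        ((F s 1 1 * deriv (fun t => F t 1 0) s - F s 1 0 * deriv (fun t => F t 1 1) s) *
          ((Complex.exp s)⁻¹ * h)) (X (Complex.exp s)) := by
  set z := Complex.exp s with hz
  have hz0 : z ≠ 0 := Complex.exp_ne_zero s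
  have hline : HasDerivAt (fun τ : ℝ => z + τ • h) h 0 := by
    simpa using ((hasDerivAt_id (0 : ℝ)).smul_const h).const_add z
  have h1 : HasDerivAt (fun τ : ℝ => X (z + τ • h)) (fderiv ℝ X z h) 0 :=
    ((hE.contDiffAt hs hz0).differentiableAt two_ne_zero).hasFDerivAt.comp_hasDerivAt_of_eq
      (0 : ℝ) hline (by simp)
  have hell : HasDerivAt (fun τ : ℝ => s + Complex.log ((z + τ • h) / z)) (z⁻¹ * h) 0 := by
    have := (hasDerivAt_local_log s z (by simp [hz])).comp_of_eq (0 : ℝ) hline (by simp)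
    exact this
  have hell0 : s + Complex.log ((z + (0 : ℝ) • h) / z) = s := by simp [hz0]
  have h2 := hasDerivAt_halfSpaceOfHermitian
    (M := fun τ : ℝ => F (s + Complex.log ((z + τ • h) / z))) (t := 0)
    (by simp only [hell0]; exact hE.det_eq_one s hs) (fun i j => by
      have := (hE.hasDerivAt hs i j).comp_of_eq (0 : ℝ) hell hell0.symm
      rw [hE.deriv_eq_mul hs] at this
      simp only [hell0]
      exact this)
  simp only [hell0] at h2
  rw [← hE.represents s hs] at h2
  refine h1.unique (h2.congr_of_eventuallyEq ?_)
  have hc : Tendsto (fun τ : ℝ => z + τ • h) (𝓝 0) (𝓝 z) := by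
    simpa using hline.continuousAt.tendsto
  exact hc.eventually (hE.eventuallyEq_local_log hs)

/-- The logarithmic derivative `dF F⁻¹` is single-valued. -/
theorem form_exp (hE : IsBryantEnd Ω X F) {s : ℂ} (hs : Complex.exp s ∈ Ω) :
    form₁ F (Complex.exp s) = (F s 1 0 * deriv (fun t => F t 0 1) s -
        F s 1 1 * deriv (fun t => F t 0 0) s) / Complex.exp s ∧
      form₂ F (Complex.exp s) = (F s 0 1 * deriv (fun t => F t 0 0) s -
        F s 0 0 * deriv (fun t => F t 0 1) s) / Complex.exp s ∧
      form₀ F (Complex.exp s) = (F s 1 1 * deriv (fun t => F t 1 0) s -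
        F s 1 0 * deriv (fun t => F t 1 1) s) / Complex.exp s := by
  have hz0 := Complex.exp_ne_zero s
  set l := Complex.log (Complex.exp s) with hl_def
  have hl : Complex.exp l = Complex.exp s := Complex.exp_log hz0
  have key := killing_coeff_unique
    (a := F s 1 1 * deriv (fun t => F t 0 0) s - F s 1 0 * deriv (fun t => F t 0 1) s)
    (b := F s 0 0 * deriv (fun t => F t 0 1) s - F s 0 1 * deriv (fun t => F t 0 0) s)
    (c := F s 1 1 * deriv (fun t => F t 1 0) s - F s 1 0 * deriv (fun t => F t 1 1) s)
    (a' := F l 1 1 * deriv (fun t => F t 0 0) l - F l 1 0 * deriv (fun t => F t 0 1) l)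
    (b' := F l 0 0 * deriv (fun t => F t 0 1) l - F l 0 1 * deriv (fun t => F t 0 0) l)
    (c' := F l 1 1 * deriv (fun t => F t 1 0) l - F l 1 0 * deriv (fun t => F t 1 1) l)
    (hE.mem_upperHalf hs hz0) (fun k => by
    have h1 := hE.fderiv_exp hs (Complex.exp s * k)
    have h2 := hE.fderiv_exp (s := l) (by rwa [hl]) (Complex.exp s * k)
    rw [hl] at h2
    rw [h1] at h2
    simp only [inv_mul_cancel_left₀ hz0] at h2
    exact h2)
  obtain ⟨k1, k2, k3⟩ := key
  refine ⟨?_, ?_, ?_⟩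
  · rw [form₁]
    congr 1
    linear_combination k1
  · rw [form₂]
    congr 1
    linear_combination k2
  · rw [form₀, k3]

theorem fderiv_eq_killing (hE : IsBryantEnd Ω X F) {z : ℂ} (hz : z ∈ Ω) (hz0 : z ≠ 0) (h : ℂ) :
    fderiv ℝ X z h = killing (-form₁ F z * h) (-form₂ F z * h) (form₀ F z * h) (X z) := by
  have hl := Complex.exp_log hz0
  have h1 := hE.fderiv_exp (s := Complex.log z) (by rwa [hl]) h
  rw [hl] at h1
  rw [h1, form₀, form₁, form₂]
  congr 1 <;> ring

/-- The left side is -det(F'F⁻¹), which vanishes since `null` says det F' = 0 and the determinant of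
F is one. Differentiating det F = 1 gives the vanishing trace. -/
theorem form_null (hE : IsBryantEnd Ω X F) {z : ℂ} (hz : z ∈ Ω) (hz0 : z ≠ 0) :
    (-form₁ F z) ^ 2 + -form₂ F z * form₀ F z = 0 := by
  have hl := Complex.exp_log hz0
  have hs : Complex.exp (Complex.log z) ∈ Ω := by rwa [hl]
  have h1 := hE.deriv_det hs
  have h2 := hE.null _ hs
  rw [form₀, form₁, form₂]
  generalize deriv (fun t => F t 0 0) (Complex.log z) = A' at *
  generalize deriv (fun t => F t 0 1) (Complex.log z) = B' at *
  generalize deriv (fun t => F t 1 0) (Complex.log z) = C' at *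
  generalize deriv (fun t => F t 1 1) (Complex.log z) = D' at *
  generalize F (Complex.log z) 0 0 = A at *
  generalize F (Complex.log z) 0 1 = B at *
  generalize F (Complex.log z) 1 0 = C at *
  generalize F (Complex.log z) 1 1 = D at *
  field_simp
  linear_combination (D * A' - C * B') * h1 - (A * D - B * C) * h2

/-- The definitions use the principal logarithm, but by `form_exp` any logarithm gives the same
value; near each point the local branch shows holomorphy, also across the cut. -/
theorem differentiableAt_form (hE : IsBryantEnd Ω X F) {z : ℂ} (hz : z ∈ Ω) (hz0 : z ≠ 0) :
    DifferentiableAt ℂ (form₀ F) z ∧ DifferentiableAt ℂ (form₁ F) z ∧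
      DifferentiableAt ℂ (form₂ F) z := by
  set s := Complex.log z with hs_def
  have hzs : Complex.exp s = z := Complex.exp_log hz0
  have hs : Complex.exp s ∈ Ω := by rwa [hzs]
  rw [← hzs]
  have hlog : DifferentiableAt ℂ (fun y => s + Complex.log (y / Complex.exp s)) (Complex.exp s) :=
    (hasDerivAt_local_log s (Complex.exp s) (by simp [Complex.exp_ne_zero])).differentiableAt
  have hl0 : s + Complex.log (Complex.exp s / Complex.exp s) = s := by
    simp [Complex.exp_ne_zero]
  have hF : ∀ i j, DifferentiableAt ℂ (fun y => F (s + Complex.log (y / Complex.exp s)) i j)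
      (Complex.exp s) := fun i j =>
    DifferentiableAt.comp (g := fun t => F t i j) (Complex.exp s)
      (by rw [hl0]; exact (hE.hasDerivAt hs i j).differentiableAt) hlog
  have hF' : ∀ i j, DifferentiableAt ℂ (fun y => deriv (fun t => F t i j)
      (s + Complex.log (y / Complex.exp s))) (Complex.exp s) := fun i j =>
    DifferentiableAt.comp (g := deriv (fun t => F t i j)) (Complex.exp s)
      (by
        rw [hl0]
        exact ((hE.holomorphic i j).deriv hE.isOpen_log).differentiableAt
          (hE.isOpen_log.mem_nhds hs)) hlog
  have hev : ∀ᶠ y in 𝓝 (Complex.exp s), y ∈ Ω ∧ y ≠ 0 := by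
    filter_upwards [hE.isOpen.mem_nhds hs, isOpen_ne.mem_nhds (Complex.exp_ne_zero s)] with y h1 h2
    exact ⟨h1, h2⟩
  have hdiv : ∀ {f : ℂ → ℂ}, DifferentiableAt ℂ f (Complex.exp s) →
      DifferentiableAt ℂ (fun y => f y / y) (Complex.exp s) := fun hf =>
    hf.div differentiableAt_id (Complex.exp_ne_zero s)
  refine ⟨?_, ?_, ?_⟩
  · refine (hdiv (((hF 1 1).mul (hF' 1 0)).sub ((hF 1 0).mul (hF' 1 1)))).congr_of_eventuallyEq ?_
    filter_upwards [hev] with y hy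
    have := (hE.form_exp (s := s + Complex.log (y / Complex.exp s))
      (by rw [exp_local_log s hy.2]; exact hy.1)).2.2
    rwa [exp_local_log s hy.2] at this
  · refine (hdiv (((hF 1 0).mul (hF' 0 1)).sub ((hF 1 1).mul (hF' 0 0)))).congr_of_eventuallyEq ?_
    filter_upwards [hev] with y hy
    have := (hE.form_exp (s := s + Complex.log (y / Complex.exp s))
      (by rw [exp_local_log s hy.2]; exact hy.1)).1
    rwa [exp_local_log s hy.2] at this
  · refine (hdiv (((hF 0 1).mul (hF' 0 0)).sub ((hF 0 0).mul (hF' 0 1)))).congr_of_eventuallyEq ?_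
    filter_upwards [hev] with y hy
    have := (hE.form_exp (s := s + Complex.log (y / Complex.exp s))
      (by rw [exp_local_log s hy.2]; exact hy.1)).2.1
    rwa [exp_local_log s hy.2] at this

end IsBryantEnd

/-! ### Conformality of the end and the side of its mean curvature vector. -/

theorem hasDerivAt_killing {a b c : ℝ → ℂ} {p : ℝ → ℂ × ℝ} {a' b' c' : ℂ} {p' : ℂ × ℝ} {t : ℝ}
    (ha : HasDerivAt a a' t) (hb : HasDerivAt b b' t) (hc : HasDerivAt c c' t)
    (hp : HasDerivAt p p' t) :
    HasDerivAt (fun τ => killing (a τ) (b τ) (c τ) (p τ))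
      (killing a' b' c' (p t) + killingDeriv (a t) (b t) (p t) p') t := by
  have h1 : HasDerivAt (fun τ => (p τ).1) p'.1 t :=
    (ContinuousLinearMap.fst ℝ ℂ ℝ).hasFDerivAt.comp_hasDerivAt t hp
  have h2 : HasDerivAt (fun τ => (p τ).2) p'.2 t :=
    (ContinuousLinearMap.snd ℝ ℂ ℝ).hasFDerivAt.comp_hasDerivAt t hp
  have hbc : HasDerivAt (fun τ => conj (b τ)) (conj b') t :=
    Complex.conjCLE.toContinuousLinearMap.hasFDerivAt.comp_hasDerivAt t hb
  have hre : HasDerivAt (fun τ => (a τ + b τ * (p τ).1).re) (a' + (b' * (p t).1 + b t * p'.1)).re t :=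
    Complex.reCLM.hasFDerivAt.comp_hasDerivAt t (ha.add (hb.mul h1))
  refine (((((hc.sub ((ha.const_mul 2).mul h1)).sub (hb.mul (h1.pow 2))).add
    (hbc.mul (h2.ofReal_comp.pow 2)))).prodMk ((hre.const_mul (-2)).mul h2)).congr_deriv ?_
  refine Prod.ext ?_ ?_
  · simp [killing, killingDeriv]
    ring
  · simp [killing, killingDeriv]
    ring

theorem killing_neg (a b c : ℂ) (p : ℂ × ℝ) : killing (-a) (-b) (-c) p = -killing a b c p := by
  refine Prod.ext ?_ ?_ <;> simp [killing] <;> ring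

namespace IsBryantEnd

variable {Ω : Set ℂ} {X : ℂ → ℂ × ℝ} {F : ℂ → Matrix (Fin 2) (Fin 2) ℂ}

/-- Differentiating the coefficients of the Killing field gives a term depending only on hk, because
they are holomorphic. It cancels in the trace over h = k = 1 and h = k = i, so only algebraic terms
decide the mean curvature. -/
theorem covDeriv₂_eq (hE : IsBryantEnd Ω X F) {z : ℂ} (hz : z ∈ Ω) (hz0 : z ≠ 0) (h k : ℂ) :
    covDeriv₂ X z h k =
      killing (-deriv (form₁ F) z * (h * k)) (-deriv (form₂ F) z * (h * k))
        (deriv (form₀ F) z * (h * k)) (X z) +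
      killingDeriv (-form₁ F z * k) (-form₂ F z * k) (X z) (fderiv ℝ X z h) +
      christoffel (X z) (fderiv ℝ X z h) (fderiv ℝ X z k) := by
  rw [covDeriv₂]
  congr 1
  have hline : HasDerivAt (fun τ : ℝ => z + τ • h) h 0 := by
    simpa using ((hasDerivAt_id (0 : ℝ)).smul_const h).const_add z
  have hX := hE.contDiffAt hz hz0
  have h1 : HasDerivAt (fun τ : ℝ => X (z + τ • h)) (fderiv ℝ X z h) 0 :=
    (hX.differentiableAt two_ne_zero).hasFDerivAt.comp_hasDerivAt_of_eq (0 : ℝ) hline (by simp)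
  have h2 : DifferentiableAt ℝ (fun y => fderiv ℝ X y k) z :=
    ((hX.fderiv_right (m := 1) (by norm_num)).differentiableAt one_ne_zero).clm_apply
      (differentiableAt_const k)
  have h3 : HasDerivAt (fun τ : ℝ => fderiv ℝ X (z + τ • h) k)
      (fderiv ℝ (fun y => fderiv ℝ X y k) z h) 0 :=
    h2.hasFDerivAt.comp_hasDerivAt_of_eq (0 : ℝ) hline (by simp)
  obtain ⟨d0, d1, d2⟩ := hE.differentiableAt_form hz hz0
  have hf : ∀ {f : ℂ → ℂ}, DifferentiableAt ℂ f z →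
      HasDerivAt (fun τ : ℝ => f (z + τ • h)) (deriv f z * h) 0 := fun hf =>
    hf.hasDerivAt.comp_of_eq (0 : ℝ) hline (by simp)
  have h4 := hasDerivAt_killing ((hf d1).neg.mul_const k) ((hf d2).neg.mul_const k)
    ((hf d0).mul_const k) h1
  have hc : Tendsto (fun τ : ℝ => z + τ • h) (𝓝 0) (𝓝 z) := by
    simpa using hline.continuousAt.tendsto
  have hev : ∀ᶠ y in 𝓝 z, y ∈ Ω ∧ y ≠ 0 := by
    filter_upwards [hE.isOpen.mem_nhds hz, isOpen_ne.mem_nhds hz0] with y h1 h2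
    exact ⟨h1, h2⟩
  have h5 := h3.unique (h4.congr_of_eventuallyEq (by
    filter_upwards [hc.eventually hev] with τ hτ
    exact hE.fderiv_eq_killing hτ.1 hτ.2 k))
  rw [h5]
  simp [mul_assoc]

theorem fderiv_one_ne_zero (hE : IsBryantEnd Ω X F) {z : ℂ} (hz : z ∈ Ω) (hz0 : z ≠ 0) :
    fderiv ℝ X z 1 ≠ 0 := fun h =>
  one_ne_zero (hE.immersion z hz hz0 (h.trans (map_zero _).symm))

/-- The mean curvature vector `H` of a Bryant surface is on the side for which `(X_u, X_v, H)` is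
direct. -/
theorem orientDet_meanCurvatureVector_pos (hE : IsBryantEnd Ω X F) {z : ℂ} (hz : z ∈ Ω)
    (hz0 : z ≠ 0) :
    0 < orientDet (fderiv ℝ X z 1) (fderiv ℝ X z Complex.I) (meanCurvatureVector X z) := by
  have hp := hE.mem_upperHalf hz hz0
  have hw : 0 < (X z).2 := hp
  have hU : fderiv ℝ X z 1 = killing (-form₁ F z) (-form₂ F z) (form₀ F z) (X z) := by
    simpa using hE.fderiv_eq_killing hz hz0 1
  have hV := hE.fderiv_eq_killing hz hz0 Complex.I
  have hU0 := hE.fderiv_one_ne_zero hz hz0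
  have hn := hE.form_null hz hz0
  have hf := eucInner_killing_I hn (X z)
  have hg := eucInner_killing_I_I hn (X z)
  have hT : covDeriv₂ X z 1 1 + covDeriv₂ X z Complex.I Complex.I =
      (2 / (X z).2) • cross (fderiv ℝ X z 1) (fderiv ℝ X z Complex.I) := by
    rw [hE.covDeriv₂_eq hz hz0, hE.covDeriv₂_eq hz hz0, hU, hV,
      ← killingDeriv_add_christoffel _ _ _ hw.ne', Complex.I_mul_I]
    simp only [mul_one, mul_neg, killing_neg]
    abel
  rw [← hU, ← hV] at hf hg
  have he := eucInner_self_pos hU0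
  refine orientDet_normal_pos hw.ne' ?_
  simp only [hypInner, hf, hg]
  set U := fderiv ℝ X z 1
  set V := fderiv ℝ X z Complex.I
  have hcross : 0 < eucInner (cross U V) (cross U V) := by
    have : eucInner (cross U V) (cross U V) =
        eucInner U U * eucInner V V - eucInner U V ^ 2 := by
      simp [eucInner, cross]
      ring
    rw [this, hf, hg]
    nlinarith
  set e := eucInner U U / (X z).2 ^ 2 with he_def
  have he0 : 0 < e := by positivity
  have : (1 / (2 * (e * e - (0 / (X z).2 ^ 2) ^ 2))) •
      (e • covDeriv₂ X z 1 1 - (2 * (0 / (X z).2 ^ 2)) • covDeriv₂ X z 1 Complex.I +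
        e • covDeriv₂ X z Complex.I Complex.I) =
      (1 / (2 * e) * (2 / (X z).2)) • cross U V := by
    rw [mul_smul (1 / (2 * e)), ← hT, zero_div, mul_zero, zero_smul, sub_zero, ← smul_add, smul_smul]
    congr 1
    field_simp
    ring
  rw [this, orientDet_smul_cross]
  positivity

theorem hypInner_fderiv (hE : IsBryantEnd Ω X F) {z : ℂ} (hz : z ∈ Ω) (hz0 : z ≠ 0) (h k : ℂ) :
    hypInner (X z) (fderiv ℝ X z h) (fderiv ℝ X z k) =
      hypInner (X z) (fderiv ℝ X z 1) (fderiv ℝ X z 1) * (conj h * k).re := by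
  have hU : fderiv ℝ X z 1 = killing (-form₁ F z) (-form₂ F z) (form₀ F z) (X z) := by
    simpa using hE.fderiv_eq_killing hz hz0 1
  rw [hU, hE.fderiv_eq_killing hz hz0, hE.fderiv_eq_killing hz hz0]
  exact hypInner_killing_mul (hE.form_null hz hz0) h k (X z)

theorem hypInner_fderiv_one_pos (hE : IsBryantEnd Ω X F) {z : ℂ} (hz : z ∈ Ω) (hz0 : z ≠ 0) :
    0 < hypInner (X z) (fderiv ℝ X z 1) (fderiv ℝ X z 1) :=
  hypInner_self_pos (ne_of_gt (hE.mem_upperHalf hz hz0)) (hE.fderiv_one_ne_zero hz hz0)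

theorem orientDet_fderiv (hE : IsBryantEnd Ω X F) {z : ℂ} (hz : z ∈ Ω) (hz0 : z ≠ 0) (h k : ℂ)
    (W : ℂ × ℝ) :
    orientDet (fderiv ℝ X z h) (fderiv ℝ X z k) W =
      (conj h * k).im * orientDet (fderiv ℝ X z 1) (fderiv ℝ X z Complex.I) W := by
  have hU : fderiv ℝ X z 1 = killing (-form₁ F z) (-form₂ F z) (form₀ F z) (X z) := by
    simpa using hE.fderiv_eq_killing hz hz0 1
  rw [hU, hE.fderiv_eq_killing hz hz0, hE.fderiv_eq_killing hz hz0, hE.fderiv_eq_killing hz hz0]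
  exact orientDet_killing_mul _ _ _ h k (X z) W

end IsBryantEnd

/-! ### The conormal and the evaluation of the flux. -/

theorem orientDet_neg (U V W : ℂ × ℝ) : orientDet U V (-W) = -orientDet U V W := by
  simp [orientDet, Matrix.det_fin_three]
  ring

namespace IsFluxChoice

variable {Ω : Set ℂ} {X : ℂ → ℂ × ℝ} {F : ℂ → Matrix (Fin 2) (Fin 2) ℂ} {ε : ℤ} {γ : ℝ → ℂ}
  {η : ℝ → ℂ × ℝ} {κ : ℂ → ℂ × ℝ}

theorem ne_zero (hc : IsFluxChoice Ω X ε γ η κ) (t : ℝ) : γ t ≠ 0 := by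
  obtain ⟨σ, -, h, -⟩ := hc.generator
  rw [h]
  exact Complex.exp_ne_zero _

theorem mem (hc : IsFluxChoice Ω X ε γ η κ) (t : ℝ) : γ t ∈ Ω := by
  obtain ⟨R, hR, h⟩ := hc.disk
  exact hR (by simpa using h t)

theorem contDiff (hc : IsFluxChoice Ω X ε γ η κ) : ContDiff ℝ 2 γ := by
  obtain ⟨σ, hσ, h, -⟩ := hc.generator
  rw [show γ = fun t => Complex.exp (σ t) from funext h]
  exact hσ.cexp

theorem hasDerivAt_comp (hc : IsFluxChoice Ω X ε γ η κ) (hE : IsBryantEnd Ω X F) (t : ℝ) :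
    HasDerivAt (fun τ => X (γ τ)) (fderiv ℝ X (γ t) (deriv γ t)) t :=
  ((hE.contDiffAt (hc.mem t) (hc.ne_zero t)).differentiableAt two_ne_zero).hasFDerivAt.comp_hasDerivAt
    t (hc.contDiff.differentiable two_ne_zero t).hasDerivAt

/-- The conormal, up to the speed of the boundary curve, is the image of the tangent vector of the
curve `γ` turned by a right angle, and `γ` runs clockwise. -/
theorem exists_conormal_eq (hc : IsFluxChoice Ω X ε γ η κ) (hE : IsBryantEnd Ω X F) (t : ℝ) :
    ε = -1 ∧ ∃ k : ℝ, k < 0 ∧ η t = fderiv ℝ X (γ t) (k • (deriv γ t * Complex.I)) ∧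
      hypNorm (X (γ t)) (deriv (fun τ => X (γ τ)) t) = -k⁻¹ := by
  have hz := hc.mem t
  have hz0 := hc.ne_zero t
  obtain ⟨v, hv, hvε⟩ := hc.conormal_toward_end t
  have hort := hc.conormal_orthogonal t
  have hunit := hc.conormal_unit t
  have hor := hc.orientation t
  have hreg := hc.regular t
  rw [(hc.hasDerivAt_comp hE t).deriv] at hort hor ⊢
  set g := deriv γ t
  have hlam := hE.hypInner_fderiv_one_pos hz hz0
  have hH := hE.orientDet_meanCurvatureVector_pos hz hz0
  rw [hv, hE.orientDet_fderiv hz hz0, orientDet_neg] at hor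
  rw [hv, hE.hypInner_fderiv hz hz0] at hort
  rw [hv, hypNorm, hE.hypInner_fderiv hz hz0] at hunit
  -- Directness of (Γ, η, -H) puts η to the right of the curve in the parameter plane. As it also
  -- points to the puncture, the curve must run clockwise.
  have him : (conj g * v).im < 0 := by nlinarith
  have hε : ε = -1 := by
    rcases hc.sign with h | h
    · rw [h] at hvε
      norm_num at hvε him
      linarith
    · exact h
  have hre : (conj g * v).re = 0 := by
    have := (mul_eq_zero.1 hort).resolve_left hlam.ne'
    simp at this ⊢
    linarith
  have hgpos : 0 < Complex.normSq g := Complex.normSq_pos.2 hreg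
  have hgC : (Complex.normSq g : ℂ) = g * conj g := (Complex.mul_conj g).symm
  refine ⟨hε, (conj g * v).im / Complex.normSq g, div_neg_of_neg_of_pos him hgpos, ?_, ?_⟩
  · rw [hv]
    congr 1
    have e : conj g * v = ((conj g * v).im : ℂ) * Complex.I := by
      apply Complex.ext
      · rw [hre]; simp
      · simp
    have hg0 : (Complex.normSq g : ℂ) ≠ 0 := by exact_mod_cast hgpos.ne'
    generalize (conj g * v).im = m at e
    rw [Complex.real_smul]
    push_cast
    field_simp
    rw [hgC]
    linear_combination g * e
  · rw [hypNorm, hE.hypInner_fderiv hz hz0]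
    rw [Real.sqrt_eq_one] at hunit
    have hvv : (conj v * v).re = (conj g * v).im ^ 2 / Complex.normSq g := by
      rw [eq_div_iff hgpos.ne']
      have : (conj v * v).re * Complex.normSq g = (conj g * v).re ^ 2 + (conj g * v).im ^ 2 := by
        simp [Complex.normSq_apply]
        ring
      rw [this, hre]
      ring
    have hgg : (conj g * g).re = Complex.normSq g := by
      simp [Complex.normSq_apply]
    rw [hvv] at hunit
    rw [hgg, Real.sqrt_eq_iff_mul_self_eq_of_pos (by
      rw [inv_div, ← neg_div]
      exact div_pos_of_neg_of_neg (neg_neg_of_pos hgpos) him)]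
    have hm := him.ne
    rw [mul_div_assoc', div_eq_one_iff_eq hgpos.ne'] at hunit
    field_simp
    linarith

end IsFluxChoice

theorem continuous_primForm_deriv {a b c : ℂ} {p : ℝ → ℂ × ℝ} (hp : ContDiff ℝ 1 p)
    (hmem : ∀ t, p t ∈ upperHalf) : Continuous fun t => primForm a b c (p t) (deriv p t) := by
  refine Continuous.clm_apply ?_ (hp.continuous_deriv le_rfl)
  exact (contDiffOn_primForm a b c).continuousOn.comp_continuous hp.continuous hmem

namespace IsFluxChoice

variable {Ω : Set ℂ} {X : ℂ → ℂ × ℝ} {F : ℂ → Matrix (Fin 2) (Fin 2) ℂ} {ε : ℤ} {γ : ℝ → ℂ}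
  {η : ℝ → ℂ × ℝ} {κ : ℂ → ℂ × ℝ}

/-- Conformality makes η times the speed of Γ equal to -dX(iγ'), so `hypInner_killing_I_mul` applies
with its sign reversed. The holomorphic term is tr(y' dF F⁻¹). -/
theorem conormal_integrand_eq (hc : IsFluxChoice Ω X ε γ η κ) (hE : IsBryantEnd Ω X F)
    {Y : ℂ × ℝ → ℂ × ℝ} {a b c : ℂ} (hY : ∀ p ∈ upperHalf, Y p = killing a b c p) (t : ℝ) :
    hypInner (X (γ t)) (η t) (Y (X (γ t))) * hypNorm (X (γ t)) (deriv (fun τ => X (γ τ)) t) =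
      primForm a b c (X (γ t)) (deriv (fun τ => X (γ τ)) t) +
        2 * ((-2 * a * form₁ F (γ t) + b * form₀ F (γ t) - c * form₂ F (γ t)) * deriv γ t).im := by
  have hz := hc.mem t
  have hz0 := hc.ne_zero t
  have hp := hE.mem_upperHalf hz hz0
  obtain ⟨-, k, hk, hη, hN⟩ := hc.exists_conormal_eq hE t
  rw [hN, hY _ hp, hη, map_smul, (hc.hasDerivAt_comp hE t).deriv, hE.fderiv_eq_killing hz hz0,
    hE.fderiv_eq_killing hz hz0]
  have h := hypInner_killing_I_mul (-form₁ F (γ t) * deriv γ t) (-form₂ F (γ t) * deriv γ t)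
    (form₀ F (γ t) * deriv γ t) a b c (ne_of_gt hp)
  have hs : ∀ (p U V : ℂ × ℝ), hypInner p (k • U) V * -k⁻¹ = -hypInner p U V := by
    intro p U V
    have hk0 := hk.ne
    simp [hypInner, eucInner]
    field_simp
  rw [hs, ← mul_assoc, ← mul_assoc, ← mul_assoc, h]
  have e : (-2 * a * form₁ F (γ t) + b * form₀ F (γ t) - c * form₂ F (γ t)) * deriv γ t =
      2 * a * (-form₁ F (γ t) * deriv γ t) + b * (form₀ F (γ t) * deriv γ t) +
        c * (-form₂ F (γ t) * deriv γ t) := by ring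
  rw [e]
  ring

/-- The minus sign is that of the clockwise curve: ε = -1 for every admissible choice. -/
theorem integral_form_eq (hc : IsFluxChoice Ω X ε γ η κ) (hE : IsBryantEnd Ω X F)
    {f : ℂ → ℂ} (hf : ∀ z ∈ Ω, z ≠ 0 → DifferentiableAt ℂ f z) :
    IntervalIntegrable (fun t => f (γ t) * deriv γ t) volume 0 (2 * Real.pi) ∧
      ∫ t in (0 : ℝ)..(2 * Real.pi), f (γ t) * deriv γ t =
        -(2 * Real.pi * Complex.I * residueAtZero f) := by
  constructor
  · refine Continuous.intervalIntegrable ?_ _ _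
    refine Continuous.mul ?_ (hc.contDiff.continuous_deriv one_le_two)
    refine continuous_iff_continuousAt.2 fun t => ?_
    exact ContinuousAt.comp (g := f) (hf _ (hc.mem t) (hc.ne_zero t)).continuousAt
      hc.contDiff.continuous.continuousAt
  · obtain ⟨σ, hσ, hγ, hper⟩ := hc.generator
    obtain ⟨R, hR, hlt⟩ := hc.disk
    have h := integral_exp_path_eq_residueAtZero (h := f) (R := R)
      (fun z hz hzR => hf z (hR (by simpa using hzR)) hz) (hσ.of_le one_le_two)
      (fun t => by rw [← hγ]; exact hlt t) hc.sign (by simpa using hper 0)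
    rw [(hc.exists_conormal_eq hE 0).1] at h
    have hd : ∀ t, deriv γ t = Complex.exp (σ t) * deriv σ t := fun t => by
      rw [show γ = fun t => Complex.exp (σ t) from funext hγ]
      exact ((hσ.differentiable two_ne_zero t).hasDerivAt.cexp).deriv
    simp_rw [hd, hγ, h]
    simp

theorem fluxIntegral_eq (hc : IsFluxChoice Ω X ε γ η κ) (hE : IsBryantEnd Ω X F)
    {Y : ℂ × ℝ → ℂ × ℝ} {a b c : ℂ} (hY : ∀ p ∈ upperHalf, Y p = killing a b c p) :
    fluxIntegral X Y γ η κ = (2 * Complex.I * a * phi₁ F - Complex.I * b * phi₀ F +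
      Complex.I * c * phi₂ F).im := by
  have hmem : ∀ t, X (γ t) ∈ upperHalf := fun t => hE.mem_upperHalf (hc.mem t) (hc.ne_zero t)
  have hXγ : ContDiff ℝ 1 fun t => X (γ t) := contDiff_iff_contDiffAt.2 fun t =>
    ((hE.contDiffAt (hc.mem t) (hc.ne_zero t)).of_le one_le_two).comp t
      (hc.contDiff.of_le one_le_two).contDiffAt
  have hprim := continuous_primForm_deriv (a := a) (b := b) (c := c) hXγ hmem
  obtain ⟨i0, r0⟩ := hc.integral_form_eq hE (f := form₀ F)
    fun z hz hz0 => (hE.differentiableAt_form hz hz0).1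
  obtain ⟨i1, r1⟩ := hc.integral_form_eq hE (f := form₁ F)
    fun z hz hz0 => (hE.differentiableAt_form hz hz0).2.1
  obtain ⟨i2, r2⟩ := hc.integral_form_eq hE (f := form₂ F)
    fun z hz hz0 => (hE.differentiableAt_form hz hz0).2.2
  have hsum : (fun t => (-2 * a * form₁ F (γ t) + b * form₀ F (γ t) - c * form₂ F (γ t)) *
      deriv γ t) = fun t => -2 * a * (form₁ F (γ t) * deriv γ t) +
        b * (form₀ F (γ t) * deriv γ t) - c * (form₂ F (γ t) * deriv γ t) := by
    funext t
    ring
  have iall : IntervalIntegrable (fun t => (-2 * a * form₁ F (γ t) + b * form₀ F (γ t) -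
      c * form₂ F (γ t)) * deriv γ t) volume 0 (2 * Real.pi) := by
    rw [hsum]
    exact ((i1.const_mul _).add (i0.const_mul _)).sub (i2.const_mul _)
  have rall : ∫ t in (0 : ℝ)..(2 * Real.pi), (-2 * a * form₁ F (γ t) + b * form₀ F (γ t) -
      c * form₂ F (γ t)) * deriv γ t =
      -2 * a * -(2 * Real.pi * Complex.I * residueAtZero (form₁ F)) +
        b * -(2 * Real.pi * Complex.I * residueAtZero (form₀ F)) -
        c * -(2 * Real.pi * Complex.I * residueAtZero (form₂ F)) := by
    rw [hsum, intervalIntegral.integral_sub ((i1.const_mul _).add (i0.const_mul _))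
      (i2.const_mul _), intervalIntegral.integral_add (i1.const_mul _) (i0.const_mul _),
      intervalIntegral.integral_const_mul, intervalIntegral.integral_const_mul,
      intervalIntegral.integral_const_mul, r0, r1, r2]
  have him : ∫ t in (0 : ℝ)..(2 * Real.pi), ((-2 * a * form₁ F (γ t) + b * form₀ F (γ t) -
      c * form₂ F (γ t)) * deriv γ t).im = _ :=
    (Complex.imCLM.intervalIntegral_comp_comm iall).trans (congrArg Complex.im rall)
  have iim : IntervalIntegrable (fun t => ((-2 * a * form₁ F (γ t) + b * form₀ F (γ t) -
      c * form₂ F (γ t)) * deriv γ t).im) volume 0 (2 * Real.pi) :=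
    ⟨Complex.imCLM.integrable_comp iall.1, Complex.imCLM.integrable_comp iall.2⟩
  -- Stokes' theorem turns the disk term into the integral of `primForm` over Γ, which cancels the
  -- first half of the conormal integrand.
  rw [fluxIntegral, two_mul_integral_disk_eq a b c hY hc.disk_smooth hc.disk_mem]
  simp_rw [hc.conormal_integrand_eq hE hY, hc.disk_boundary]
  rw [intervalIntegral.integral_add (hprim.intervalIntegrable _ _) (iim.const_mul 2),
    add_sub_cancel_left, intervalIntegral.integral_const_mul, him]
  have p0 : phi₀ F = 4 * Real.pi * residueAtZero (form₀ F) := rfl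
  have p1 : phi₁ F = 4 * Real.pi * residueAtZero (form₁ F) := rfl
  have p2 : phi₂ F = 4 * Real.pi * residueAtZero (form₂ F) := rfl
  have e : 2 * Complex.I * a * phi₁ F - Complex.I * b * phi₀ F + Complex.I * c * phi₂ F =
      (2 : ℝ) * (-2 * a * -(2 * Real.pi * Complex.I * residueAtZero (form₁ F)) +
        b * -(2 * Real.pi * Complex.I * residueAtZero (form₀ F)) -
        c * -(2 * Real.pi * Complex.I * residueAtZero (form₂ F))) := by
    rw [p0, p1, p2]
    push_cast
    ring
  rw [e, Complex.im_ofReal_mul]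

end IsFluxChoice

/-! ### From the matrix of the rotation to its endpoints. -/

/-- The endpoints b/d and a/c differ by -1/(cd), by the determinant, so clearing denominators leaves
a quadratic expression in a, b, c, d. It stays valid when c or d vanishes, which is the case of an
endpoint at infinity. -/
theorem endpointQuotient_eq (φ₀ φ₁ φ₂ : ℂ) {a b c d : ℂ} (hdet : a * d - b * c = 1) :
    endpointQuotient φ₀ φ₁ φ₂ (if d = 0 then OnePoint.infty else (b / d : ℂ))
      (if c = 0 then OnePoint.infty else (a / c : ℂ)) =
      -((a * d + b * c) * φ₁ + c * d * φ₀ + a * b * φ₂) := by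
  by_cases hd : d = 0
  · have hc : c ≠ 0 := by
      rintro rfl
      simp [hd] at hdet
    simp only [hd, hc, if_true, if_false, endpointQuotient, OnePoint.elim_infty,
      OnePoint.elim_some]
    subst hd
    field_simp
    linear_combination (-φ₂ * a - φ₁ * c) * hdet
  · by_cases hc : c = 0
    · simp only [hd, hc, if_true, if_false, endpointQuotient, OnePoint.elim_infty,
        OnePoint.elim_some]
      subst hc
      field_simp
      linear_combination (φ₂ * b + φ₁ * d) * hdet
    · simp only [hd, hc, if_false, endpointQuotient, OnePoint.elim_some]
      have h : b / d - a / c = -1 / (c * d) := by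
        field_simp
        linear_combination -hdet
      rw [h]
      field_simp
      ring

/-! ### Existence of admissible curves, conormals and disks. -/

namespace IsBryantEnd

variable {Ω : Set ℂ} {X : ℂ → ℂ × ℝ} {F : ℂ → Matrix (Fin 2) (Fin 2) ℂ}

/-- A disk spanned by the image of a circle about the puncture. -/
theorem exists_disk (hE : IsBryantEnd Ω X F) {r R : ℝ} (hR : Metric.ball 0 R ⊆ Ω) (hr : 0 < r)
    (hrR : r < R) :
    ∃ κ : ℂ → ℂ × ℝ, ContDiffOn ℝ 2 κ (Metric.closedBall 0 1) ∧
      MapsTo κ (Metric.closedBall 0 1) upperHalf ∧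
      ∀ t : ℝ, κ (Complex.exp (t * Complex.I)) = X (r * conj (Complex.exp (t * Complex.I))) := by
  let χ : ContDiffBump (0 : ℂ) := ⟨1 / 4, 1 / 2, by norm_num, by norm_num⟩
  let p₀ : ℂ × ℝ := (0, 1)
  have hmem : ∀ z ∈ Metric.closedBall (0 : ℂ) 1, r * conj z ∈ Ω := fun z hz => hR (by
    have hz1 : ‖z‖ ≤ 1 := by simpa using hz
    simp only [Metric.mem_ball, dist_zero_right, norm_mul, Complex.norm_real, Real.norm_eq_abs,
      abs_of_pos hr, RCLike.norm_conj]
    nlinarith)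
  -- X may have no extension to the puncture, so the bump function contracts its image to p₀ = (0,
  -- 1) there; convexity of the half-space keeps the disk inside. Conjugation makes the boundary
  -- clockwise.
  refine ⟨fun z => p₀ + (1 - χ z) • (X (r * conj z) - p₀), ?_, ?_, ?_⟩
  · intro z hz
    by_cases hz0 : z = 0
    · have hev : (fun z => p₀ + (1 - χ z) • (X (r * conj z) - p₀)) =ᶠ[𝓝 z] fun _ => p₀ := by
        rw [hz0]
        filter_upwards [χ.eventuallyEq_one] with y hy
        simp [hy]
      exact (contDiffAt_const.congr_of_eventuallyEq hev).contDiffWithinAt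
    · have h1 : ContDiffAt ℝ 2 (fun z : ℂ => r * conj z) z :=
        contDiffAt_const.mul Complex.conjCLE.contDiff.contDiffAt
      have h2 : ContDiffAt ℝ 2 X (r * conj z) :=
        hE.contDiffAt (hmem z hz) (by simpa [hr.ne'] using hz0)
      have h3 : ContDiffAt ℝ 2 (fun z => X (r * conj z)) z := h2.comp z h1
      exact (contDiffAt_const.add ((contDiffAt_const.sub χ.contDiffAt).smul
        (h3.sub contDiffAt_const))).contDiffWithinAt
  · intro z hz
    have h0 := χ.nonneg (x := z)
    have h1 := χ.le_one (x := z)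
    change 0 < (p₀ + (1 - χ z) • (X (r * conj z) - p₀)).2
    by_cases hz0 : z = 0
    · have : χ z = 1 := by
        rw [hz0]
        exact χ.eventuallyEq_one.self_of_nhds
      simp [this, p₀]
    · have hX : 0 < (X (r * conj z)).2 :=
        hE.mem_upperHalf (hmem z hz) (by simpa [hr.ne'] using hz0)
      simp only [Prod.snd_add, Prod.smul_snd, Prod.snd_sub, smul_eq_mul, p₀]
      rcases h0.eq_or_lt with h | h
      · rw [← h]
        linarith
      · nlinarith [mul_nonneg (sub_nonneg.2 h1) hX.le]
  · intro t
    have : χ (Complex.exp (t * Complex.I)) = 0 := by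
      refine χ.zero_of_le_dist ?_
      rw [dist_zero_right, Complex.norm_exp_ofReal_mul_I]
      norm_num [χ]
    simp [this]

theorem exists_isFluxChoice (hE : IsBryantEnd Ω X F) : ∃ ε γ η κ, IsFluxChoice Ω X ε γ η κ := by
  obtain ⟨R, hR0, hR⟩ := Metric.isOpen_iff.1 hE.isOpen 0 hE.zero_mem
  set r := R / 2 with hr_def
  have hr : 0 < r := by positivity
  have hrR : r < R := half_lt_self hR0
  obtain ⟨κ, hκ, hκm, hκb⟩ := hE.exists_disk hR hr hrR
  set σ : ℝ → ℂ := fun t => Real.log r - t * Complex.I with hσ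
  set γ : ℝ → ℂ := fun t => Complex.exp (σ t) with hγ
  have hσd : ContDiff ℝ 2 σ := contDiff_const.sub (Complex.ofRealCLM.contDiff.mul contDiff_const)
  have hσ' : ∀ t, HasDerivAt σ (-Complex.I) t := fun t => by
    have := (((hasDerivAt_id t).ofReal_comp).mul_const Complex.I).const_sub (Real.log r : ℂ)
    simpa using this
  have hγ' : ∀ t, HasDerivAt γ (γ t * -Complex.I) t := fun t => (hσ' t).cexp
  have hnorm : ∀ t, ‖γ t‖ = r := fun t => by
    simp [hγ, hσ, Complex.norm_exp, Real.exp_log hr]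
  have hγ0 : ∀ t, γ t ≠ 0 := fun t => Complex.exp_ne_zero _
  have hγΩ : ∀ t, γ t ∈ Ω := fun t => hR (by simpa [hnorm] using hrR)
  have hreg : ∀ t, deriv γ t ≠ 0 := fun t => by
    rw [(hγ' t).deriv]
    exact mul_ne_zero (hγ0 t) (neg_ne_zero.2 Complex.I_ne_zero)
  have hΓ : ∀ t, deriv (fun τ => X (γ τ)) t = fderiv ℝ X (γ t) (deriv γ t) := fun t =>
    (((hE.contDiffAt (hγΩ t) (hγ0 t)).differentiableAt two_ne_zero).hasFDerivAt.comp_hasDerivAt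
      t (hγ' t).differentiableAt.hasDerivAt).deriv
  have hsq : ∀ t, 0 < Complex.normSq (deriv γ t) := fun t => Complex.normSq_pos.2 (hreg t)
  set l : ℝ → ℝ := fun t => √(hypInner (X (γ t)) (fderiv ℝ X (γ t) 1) (fderiv ℝ X (γ t) 1) *
    Complex.normSq (deriv γ t)) with hl
  have hl0 : ∀ t, 0 < l t := fun t =>
    Real.sqrt_pos.2 (mul_pos (hE.hypInner_fderiv_one_pos (hγΩ t) (hγ0 t)) (hsq t))
  -- On a clockwise curve the puncture lies to the right, in the direction -iγ'; dividing by the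
  -- speed `l` of Γ gives a unit conormal.
  set v : ℝ → ℂ := fun t => -((l t)⁻¹ : ℝ) * (Complex.I * deriv γ t) with hv
  have hgv : ∀ t, conj (deriv γ t) * v t =
      -(((l t)⁻¹ * Complex.normSq (deriv γ t) : ℝ) : ℂ) * Complex.I := fun t => by
    have := Complex.mul_conj (deriv γ t)
    simp only [hv]
    push_cast
    rw [← this]
    ring
  refine ⟨-1, γ, fun t => fderiv ℝ X (γ t) (v t), κ, ?_⟩
  refine
    { sign := Or.inr rfl
      generator := ⟨σ, hσd, fun t => rfl, fun t => by simp [hσ]; ring⟩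
      disk := ⟨R, hR, fun t => by rw [hnorm]; exact hrR⟩
      regular := hreg
      conormal_unit := fun t => ?_
      conormal_orthogonal := fun t => ?_
      conormal_toward_end := fun t => ⟨v t, rfl, ?_⟩
      orientation := fun t => ?_
      disk_smooth := hκ
      disk_mem := hκm
      disk_boundary := fun t => ?_ }
  · rw [hypNorm, hE.hypInner_fderiv (hγΩ t) (hγ0 t), Real.sqrt_eq_one]
    have h1 : (conj (v t) * v t).re = ((l t)⁻¹) ^ 2 * Complex.normSq (deriv γ t) := by
      simp [hv, Complex.normSq_apply]
      ring
    have h2 : l t ^ 2 = hypInner (X (γ t)) (fderiv ℝ X (γ t) 1) (fderiv ℝ X (γ t) 1) *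
        Complex.normSq (deriv γ t) :=
      Real.sq_sqrt (mul_pos (hE.hypInner_fderiv_one_pos (hγΩ t) (hγ0 t)) (hsq t)).le
    rw [h1, mul_left_comm, ← h2, ← mul_pow, inv_mul_cancel₀ (hl0 t).ne', one_pow]
  · rw [hΓ, hE.hypInner_fderiv (hγΩ t) (hγ0 t)]
    have : (conj (v t) * deriv γ t).re = (conj (deriv γ t) * v t).re := by
      simp
      ring
    rw [this, hgv]
    simp
  · rw [hgv]
    have := mul_pos (inv_pos.2 (hl0 t)) (hsq t)
    rw [neg_mul, Complex.neg_im, Complex.im_ofReal_mul, Complex.I_im, mul_one]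
    push_cast
    linarith
  · rw [hΓ, hE.orientDet_fderiv (hγΩ t) (hγ0 t), orientDet_neg, hgv, neg_mul, Complex.neg_im,
      Complex.im_ofReal_mul, Complex.I_im, mul_one, neg_mul_neg]
    exact mul_pos (mul_pos (inv_pos.2 (hl0 t)) (hsq t))
      (hE.orientDet_meanCurvatureVector_pos (hγΩ t) (hγ0 t))
  · rw [hκb]
    congr 1
    simp only [hγ, hσ]
    rw [sub_eq_add_neg, Complex.exp_add, ← Complex.ofReal_exp, Real.exp_log hr, ← Complex.exp_conj]
    simp

end IsBryantEnd

end BryantFlux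

end

theorem theorem3p2 (Ω : Set ℂ) (X : ℂ → ℂ × ℝ) (F : ℂ → Matrix (Fin 2) (Fin 2) ℂ)
    (hE : IsBryantEnd Ω X F) (𝒞 𝒟 : OnePoint ℂ) (h𝒞𝒟 : 𝒞 ≠ 𝒟)
    (Y : ℂ × ℝ → ℂ × ℝ) (hY : IsRotationKillingField 𝒞 𝒟 Y) :
    HasFlux Ω X Y (-(endpointQuotient (phi₀ F) (phi₁ F) (phi₂ F) 𝒞 𝒟).im) := by
  refine ⟨hE.exists_isFluxChoice, fun ε γ η κ hc => ?_⟩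
  obtain ⟨a, b, c, d, hdet, h𝒞, h𝒟, hYk⟩ := hY.exists_killing
  rw [hc.fluxIntegral_eq hE hYk, h𝒞, h𝒟, endpointQuotient_eq _ _ _ hdet, ← Complex.neg_im, neg_neg]
  congr 1
  linear_combination (-(a * d + b * c) * phi₁ F - c * d * phi₀ F - a * b * phi₂ F) * Complex.I_sq
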